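/- Let $s\in(0,1)$, let $N\ge 1$ be an integer with $N>2s$, and let $\Omega\subset\mathbb{R}^N$ be a nonempty bounded open set (in particular, any smooth bounded domain). Let $$C(N,s)=\Big(\int_{\mathbb{R}^N}\frac{1-\cos\zeta_1}{|\zeta|^{N+2s}}\,d\zeta\Big)^{-1}=\frac{s\,4^s\,\Gamma(\frac N2+s)}{\pi^{N/2}\,\Gamma(1-s)},\qquad 2^*_s=\frac{2N}{N-2s},$$ $$\langle u,\varphi\rangle_X=\frac{C(N,s)}{2}\int_{\mathbb{R}^{2N}}\frac{(u(x)-u(y))(\varphi(x)-\varphi(y))}{|x-y|^{N+2s}}\,dx\,dy,$$ and let $X(\Omega)$ be the space of all $u\in L^2(\mathbb{R}^N)$ with $\langle u,u\rangle_X<\infty$ and $u=0$ a.e. in $\mathbb{R}^N\setminus\Omega$. Let $\lambda_{1,s}$ be the first eigenvalue of $(-\Delta)^s$ in $\Omega$ with homogeneous Dirichlet exterior condition, that is, the smallest $\lambda\in\mathbb{R}$ for which there is $e\in X(\Omega)\setminus\{0\}$ with $\langle e,\varphi\rangle_X=\lambda\int_\Omega e\,\varphi\,dx$ for all $\varphi\in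 X(\Omega)$. Let $p,q>1$ and $a,b,c\in\mathbb{R}$, and let $\mu_1\le\mu_2$ be the eigenvalues of the matrix $\begin{pmatrix}a&b\\ b&c\end{pmatrix}$. **Theorem (Existence, subcritical case).** Assume that $b\ge 0$, $\mu_2<\lambda_{1,s}$ and $p+q<2^*_s$. Then the system $$\left\{\begin{aligned} (-\Delta)^s u&=au+bv+\tfrac{2p}{p+q}\,u^{p-1}v^q &&\text{in }\Omega,\\ (-\Delta)^s v&=bu+cv+\tfrac{2q}{p+q}\,u^{p}v^{q-1} &&\text{in }\Omega,\\ u&>0,\quad v>0 &&\text{in }\Omega,\\ u&=v=0 &&\text{in }\mathbb{R}^N\setminus\Omega \end{aligned}\right.$$ admits a weak solution: there are $u,v\in X(\Omega)$ with $u>0$ and $v>0$ a.e. in $\Omega$ such that, for all $\varphi,\psi\in X(\Omega)$, the integrals on the right-hand side below converge absolutely and $$\langle u,\varphi\rangle_X+\langle v,\psi\rangle_X=\int_\Omega\Big(au+bv+\tfrac{2p}{p+q}u^{p-1}v^q\Big)\varphi\,dx+\int_\Omega\Big(bu+cv+\tfrac{2q}{p+q}u^{p}v^{q-1}\Big)\psi\,dx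 .$$ -/

import Mathlib

open MeasureTheory

noncomputable section

namespace FracSystem

/-- The normalising constant `C(N,s)` of the fractional Laplacian on `ℝ^N`, i.e. the inverse of
`∫ (1 - cos ζ₁) / |ζ|^(N+2s) dζ`, in its closed form
`s 4^s Γ(N/2 + s) / (π^(N/2) Γ(1 - s))`. -/
def fracConst (N : ℕ) (s : ℝ) : ℝ :=
  s * (4 : ℝ) ^ s * Real.Gamma ((N : ℝ) / 2 + s) /
    (Real.pi ^ ((N : ℝ) / 2) * Real.Gamma (1 - s))

/-- The fractional critical Sobolev exponent `2N / (N - 2s)` (used for `N > 2s`). -/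
def critExp (N : ℕ) (s : ℝ) : ℝ := 2 * (N : ℝ) / ((N : ℝ) - 2 * s)

variable {N : ℕ}

/-- The integrand `(u(x)-u(y)) (v(x)-v(y)) / |x-y|^(N+2s)` on `ℝ^N × ℝ^N`. -/
def gagliardoKernel (s : ℝ) (u v : EuclideanSpace ℝ (Fin N) → ℝ)
    (z : EuclideanSpace ℝ (Fin N) × EuclideanSpace ℝ (Fin N)) : ℝ :=
  (u z.1 - u z.2) * (v z.1 - v z.2) / ‖z.1 - z.2‖ ^ ((N : ℝ) + 2 * s)

/-- The bilinear form
`⟨u,v⟩_X = C(N,s)/2 ∬ (u(x)-u(y)) (v(x)-v(y)) / |x-y|^(N+2s) dx dy`. -/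
def innerX (s : ℝ) (u v : EuclideanSpace ℝ (Fin N) → ℝ) : ℝ :=
  fracConst N s / 2 * ∫ z, gagliardoKernel s u v z ∂(volume.prod volume)

/-- Membership in `X(Ω)`: `u ∈ L²(ℝ^N)`, the Gagliardo seminorm of `u` is finite, and `u = 0`
a.e. outside `Ω`. -/
structure MemX (s : ℝ) (Ω : Set (EuclideanSpace ℝ (Fin N)))
    (u : EuclideanSpace ℝ (Fin N) → ℝ) : Prop where
  memLp : MemLp u 2 volume
  finite_seminorm : Integrable (gagliardoKernel s u u) (volume.prod volume)
  zero_outside : ∀ᵐ x ∂(volume : Measure (EuclideanSpace ℝ (Fin N))), x ∉ Ω → u x = 0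

/-- `lam` is an eigenvalue of `(-Δ)^s` in `Ω` with homogeneous Dirichlet exterior condition:
there is a nonzero `e ∈ X(Ω)` with `(-Δ)^s e = lam e` weakly in `Ω`. -/
def IsDirichletEigenvalue (s : ℝ) (Ω : Set (EuclideanSpace ℝ (Fin N))) (lam : ℝ) : Prop :=
  ∃ e : EuclideanSpace ℝ (Fin N) → ℝ, MemX s Ω e ∧ ¬ (e =ᵐ[volume] 0) ∧
    ∀ φ : EuclideanSpace ℝ (Fin N) → ℝ, MemX s Ω φ →
      innerX s e φ = lam * ∫ x in Ω, e x * φ x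

/-- The first Dirichlet eigenvalue `λ_{1,s}` of `(-Δ)^s` in `Ω`. -/
def firstEigenvalue (s : ℝ) (Ω : Set (EuclideanSpace ℝ (Fin N))) : ℝ :=
  sInf {lam : ℝ | IsDirichletEigenvalue s Ω lam}

/-- `(u,v) ∈ X(Ω) × X(Ω)` is a weak solution of `(-Δ)^s u = f(u,v)`, `(-Δ)^s v = g(u,v)` in `Ω`,
`u = v = 0` outside `Ω`. The integrability of the right-hand sides against test functions is part
of the notion, so that the integrals are meaningful. -/
structure IsWeakSolution (s : ℝ) (Ω : Set (EuclideanSpace ℝ (Fin N))) (f g : ℝ → ℝ → ℝ)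
    (u v : EuclideanSpace ℝ (Fin N) → ℝ) : Prop where
  mem_left : MemX s Ω u
  mem_right : MemX s Ω v
  integrable_left : ∀ φ : EuclideanSpace ℝ (Fin N) → ℝ, MemX s Ω φ →
    IntegrableOn (fun x => f (u x) (v x) * φ x) Ω volume
  integrable_right : ∀ ψ : EuclideanSpace ℝ (Fin N) → ℝ, MemX s Ω ψ →
    IntegrableOn (fun x => g (u x) (v x) * ψ x) Ω volume
  weak_eq : ∀ φ ψ : EuclideanSpace ℝ (Fin N) → ℝ, MemX s Ω φ → MemX s Ω ψ →
    innerX s u φ + innerX s v ψ =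
      (∫ x in Ω, f (u x) (v x) * φ x) + ∫ x in Ω, g (u x) (v x) * ψ x

/-- `(u,v)` is a (weak) solution of the system
`(-Δ)^s u = a u + b v + 2p/(p+q) u^(p-1) v^q`, `(-Δ)^s v = b u + c v + 2q/(p+q) u^p v^(q-1)` in
`Ω`, with `u > 0`, `v > 0` in `Ω` and `u = v = 0` outside `Ω`. -/
structure IsPositiveSolution (s : ℝ) (Ω : Set (EuclideanSpace ℝ (Fin N))) (a b c p q : ℝ)
    (u v : EuclideanSpace ℝ (Fin N) → ℝ) : Prop where
  isWeakSolution : IsWeakSolution s Ω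
    (fun z w => a * z + b * w + 2 * p / (p + q) * (z ^ (p - 1) * w ^ q))
    (fun z w => b * z + c * w + 2 * q / (p + q) * (z ^ p * w ^ (q - 1))) u v
  pos_left : ∀ᵐ x ∂(volume : Measure (EuclideanSpace ℝ (Fin N))), x ∈ Ω → 0 < u x
  pos_right : ∀ᵐ x ∂(volume : Measure (EuclideanSpace ℝ (Fin N))), x ∈ Ω → 0 < v x

end FracSystem

end

/-! The solution is a rescaled maximiser of the coupling $\int |u|^p|v|^q$ under $J(u,v)\le 1$,
where $J$ is the quadratic form of the linear part. The Poincaré inequality, the quadratic bound by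
$\mu_2$ and $\mu_2<\lambda_{1,s}$ make $J$ coercive (`exists_coercive`). Subcriticality gives
compactness in $L^{p+q}$, so a maximiser exists (`exists_maximizer`). As $b\ge 0$, passing to
$(|u|,|v|)$ does not raise $J$ and leaves the coupling unchanged, so the maximiser may be taken
nonnegative.

By homogeneity the maximum $S$ satisfies $\int|f|^p|g|^q\le S\,J(f,g)^{(p+q)/2}$ for all pairs, with
equality at the maximiser. Differentiating the difference of the two sides along lines gives the
Euler–Lagrange equation without a multiplier theorem. Since $p+q>2$, a dilation then normalises the
constant (`exists_nonneg_solution`). Each component is a nontrivial nonnegative supersolution of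
$(-\Delta)^s w+Mw=0$, hence positive a.e. in $\Omega$ (`ae_pos_of_supersolution`).

The analytic tools rest on ball means: $|f-f_h|^2\le C h^{2s}D$ pointwise, with $D$ the energy
density (`sq_sub_ballMean_le`). Choosing $h$ at each point gives the Sobolev inequality. Letting
$h\to0$ uniformly along a bounded sequence, whose means converge by weak $L^2$ compactness, gives
compactness in $L^2$; interpolation then reaches every subcritical $L^r$. As $\lambda_{1,s}$ is an
infimum of eigenvalues, the Poincaré inequality also requires that the best constant be attained at
an eigenfunction (`firstEigenvalue_mul_le`). -/

open MeasureTheory Filter Topology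

noncomputable section

namespace FracSystem

variable {N : ℕ} {s : ℝ} {Ω : Set (EuclideanSpace ℝ (Fin N))}
  {u v w f g φ ψ : EuclideanSpace ℝ (Fin N) → ℝ} {p q : ℝ}

/-! ### Pointwise algebra of the Gagliardo kernel -/

section Kernel

lemma gagliardoKernel_self_nonneg (s : ℝ) (u : EuclideanSpace ℝ (Fin N) → ℝ)
    (z : EuclideanSpace ℝ (Fin N) × EuclideanSpace ℝ (Fin N)) : 0 ≤ gagliardoKernel s u u z := by
  unfold gagliardoKernel
  exact div_nonneg (mul_self_nonneg _) (by positivity)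

lemma gagliardoKernel_comm (s : ℝ) (u v : EuclideanSpace ℝ (Fin N) → ℝ) :
    gagliardoKernel s u v = gagliardoKernel s v u := by
  funext z; simp only [gagliardoKernel, mul_comm]

lemma gagliardoKernel_add_left (s : ℝ) (u v w : EuclideanSpace ℝ (Fin N) → ℝ) :
    gagliardoKernel s (u + v) w = gagliardoKernel s u w + gagliardoKernel s v w := by
  funext z; simp only [gagliardoKernel, Pi.add_apply]; ring

lemma gagliardoKernel_smul_left (s c : ℝ) (u w : EuclideanSpace ℝ (Fin N) → ℝ) :
    gagliardoKernel s (c • u) w = c • gagliardoKernel s u w := by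
  funext z; simp only [gagliardoKernel, Pi.smul_apply, smul_eq_mul]; ring

lemma abs_gagliardoKernel_le (s : ℝ) (u v : EuclideanSpace ℝ (Fin N) → ℝ)
    (z : EuclideanSpace ℝ (Fin N) × EuclideanSpace ℝ (Fin N)) :
    |gagliardoKernel s u v z| ≤ gagliardoKernel s u u z + gagliardoKernel s v v z := by
  simp only [gagliardoKernel]
  have hd : 0 ≤ ‖z.1 - z.2‖ ^ ((N : ℝ) + 2 * s) := by positivity
  rw [← add_div, abs_div, abs_of_nonneg hd]
  refine div_le_div_of_nonneg_right ?_ hd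
  rw [abs_le]
  constructor <;> nlinarith [sq_nonneg ((u z.1 - u z.2) + (v z.1 - v z.2)),
    sq_nonneg ((u z.1 - u z.2) - (v z.1 - v z.2)), sq_nonneg (u z.1 - u z.2),
    sq_nonneg (v z.1 - v z.2)]

lemma aestronglyMeasurable_gagliardoKernel (s : ℝ) (hu : AEStronglyMeasurable u volume)
    (hv : AEStronglyMeasurable v volume) :
    AEStronglyMeasurable (gagliardoKernel s u v) (volume.prod volume) := by
  have h : Measurable fun z : EuclideanSpace ℝ (Fin N) × EuclideanSpace ℝ (Fin N) =>
      ‖z.1 - z.2‖ ^ ((N : ℝ) + 2 * s) := by fun_prop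
  exact (((hu.comp_fst.sub hu.comp_snd).mul (hv.comp_fst.sub hv.comp_snd)).aemeasurable.div
    h.aemeasurable).aestronglyMeasurable

lemma gagliardoKernel_le_of_le {z : EuclideanSpace ℝ (Fin N) × EuclideanSpace ℝ (Fin N)}
    (h : |w z.1 - w z.2| ≤ |f z.1 - f z.2| + |g z.1 - g z.2|) :
    gagliardoKernel s w w z ≤ 2 * (gagliardoKernel s f f z + gagliardoKernel s g g z) := by
  simp only [gagliardoKernel]
  rw [← add_div, ← mul_div_assoc]
  refine div_le_div_of_nonneg_right ?_ (by positivity)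
  rw [← abs_mul_abs_self (w _ - _), ← abs_mul_abs_self (f _ - _), ← abs_mul_abs_self (g _ - _)]
  nlinarith [mul_self_le_mul_self (abs_nonneg _) h, sq_nonneg (|f z.1 - f z.2| - |g z.1 - g z.2|)]

end Kernel

/-! ### Stability of $X(\Omega)$ under linear and lattice operations -/

namespace MemX

/-- A common source for sums, absolute values, positive parts and truncations; the last three are
1-Lipschitz maps fixing $0$ and use $g=0$. -/
lemma of_le (hf : MemX s Ω f) (hg : MemX s Ω g) (hw : AEStronglyMeasurable w volume)
    (h0 : ∀ x, |w x| ≤ |f x| + |g x|)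
    (h1 : ∀ x y, |w x - w y| ≤ |f x - f y| + |g x - g y|) : MemX s Ω w where
  memLp := by
    refine (hf.memLp.norm.add hg.memLp.norm).mono' hw (.of_forall fun x => ?_)
    simpa using h0 x
  finite_seminorm := by
    refine ((hf.finite_seminorm.add hg.finite_seminorm).const_mul 2).mono'
      (aestronglyMeasurable_gagliardoKernel s hw hw) (.of_forall fun z => ?_)
    rw [Real.norm_of_nonneg (gagliardoKernel_self_nonneg s w z)]
    exact gagliardoKernel_le_of_le (h1 _ _)
  zero_outside := by
    filter_upwards [hf.zero_outside, hg.zero_outside] with x h2 h3 hx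
    have := h0 x
    rw [h2 hx, h3 hx] at this
    simpa using this

lemma aesm (hf : MemX s Ω f) : AEStronglyMeasurable f volume := hf.memLp.1

lemma add (hf : MemX s Ω f) (hg : MemX s Ω g) : MemX s Ω (f + g) :=
  of_le hf hg (hf.aesm.add hg.aesm) (fun x => abs_add_le _ _) fun x y => by
    simp only [Pi.add_apply]
    rw [add_sub_add_comm]; exact abs_add_le _ _

lemma smul (c : ℝ) (hf : MemX s Ω f) : MemX s Ω (c • f) where
  memLp := hf.memLp.const_smul c
  finite_seminorm := by
    rw [gagliardoKernel_smul_left, gagliardoKernel_comm, gagliardoKernel_smul_left]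
    exact (hf.finite_seminorm.smul c).smul c
  zero_outside := by
    filter_upwards [hf.zero_outside] with x h hx
    simp [h hx]

lemma neg (hf : MemX s Ω f) : MemX s Ω (-f) := by
  simpa using hf.smul (-1)

lemma sub (hf : MemX s Ω f) (hg : MemX s Ω g) : MemX s Ω (f - g) := by
  rw [sub_eq_add_neg]; exact hf.add hg.neg

protected lemma zero (s : ℝ) (Ω : Set (EuclideanSpace ℝ (Fin N))) : MemX s Ω 0 where
  memLp := MemLp.zero
  finite_seminorm := by
    have : gagliardoKernel s (0 : EuclideanSpace ℝ (Fin N) → ℝ) 0 = 0 := by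
      funext z; simp [gagliardoKernel]
    rw [this]; exact integrable_zero _ _ _
  zero_outside := .of_forall fun _ _ => rfl

lemma abs (hf : MemX s Ω f) : MemX s Ω (fun x => |f x|) :=
  of_le hf (MemX.zero s Ω) hf.aesm.norm (fun x => by simp) fun x y => by
    simpa using abs_abs_sub_abs_le_abs_sub (f x) (f y)

lemma posPart (hf : MemX s Ω f) : MemX s Ω (fun x => max (f x) 0) :=
  of_le hf (MemX.zero s Ω) (hf.aesm.sup aestronglyMeasurable_const)
    (fun x => by simpa [abs_le] using le_abs_self (f x))
    fun x y => by
      simpa using abs_max_sub_max_le_abs (f x) (f y) 0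

lemma truncate (hf : MemX s Ω f) {M : ℝ} (hM : 0 ≤ M) :
    MemX s Ω (fun x => max (-M) (min (f x) M)) :=
  of_le hf (MemX.zero s Ω) (aestronglyMeasurable_const.sup (hf.aesm.inf aestronglyMeasurable_const))
    (fun x => by simp [abs_le]; constructor <;> grind)
    fun x y => by simp only [Pi.zero_apply, sub_zero, abs_zero, add_zero]; grind

lemma integrable_kernel (hf : MemX s Ω f) (hg : MemX s Ω g) :
    Integrable (gagliardoKernel s f g) (volume.prod volume) :=
  (hf.finite_seminorm.add hg.finite_seminorm).mono'
    (aestronglyMeasurable_gagliardoKernel s hf.aesm hg.aesm)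
    (.of_forall fun z => abs_gagliardoKernel_le s f g z)

lemma integrable_mul (hf : MemX s Ω f) (hg : MemX s Ω g) : Integrable (fun x => f x * g x) :=
  hf.memLp.integrable_mul hg.memLp

lemma setIntegral_eq (hf : MemX s Ω f) (F : EuclideanSpace ℝ (Fin N) → ℝ) :
    ∫ x in Ω, F x * f x = ∫ x, F x * f x := by
  refine setIntegral_eq_integral_of_ae_compl_eq_zero ?_
  filter_upwards [hf.zero_outside] with x h hx
  simp [h hx]

end MemX

lemma fracConst_pos (hs0 : 0 < s) (hs1 : s < 1) : 0 < fracConst N s := by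
  have h1 : 0 < Real.Gamma ((N : ℝ) / 2 + s) := Real.Gamma_pos_of_pos (by positivity)
  have h2 : 0 < Real.Gamma (1 - s) := Real.Gamma_pos_of_pos (by linarith)
  unfold fracConst
  positivity

/-! ### The energy form -/

section InnerX

lemma innerX_comm (s : ℝ) (u v : EuclideanSpace ℝ (Fin N) → ℝ) :
    innerX s u v = innerX s v u := by
  rw [innerX, innerX, gagliardoKernel_comm]

lemma innerX_add_left (hu : MemX s Ω u) (hv : MemX s Ω v) (hw : MemX s Ω w) :
    innerX s (u + v) w = innerX s u w + innerX s v w := by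
  rw [innerX, gagliardoKernel_add_left,
    integral_add' (hu.integrable_kernel hw) (hv.integrable_kernel hw), mul_add, innerX, innerX]

lemma innerX_smul_left (s c : ℝ) (u w : EuclideanSpace ℝ (Fin N) → ℝ) :
    innerX s (c • u) w = c * innerX s u w := by
  rw [innerX, innerX, gagliardoKernel_smul_left]
  simp only [Pi.smul_apply, smul_eq_mul, integral_const_mul]
  ring

lemma innerX_add_smul (hu : MemX s Ω u) (hv : MemX s Ω v) (t : ℝ) :
    innerX s (u + t • v) (u + t • v) =
      innerX s u u + 2 * t * innerX s u v + t ^ 2 * innerX s v v := by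
  have htv := hv.smul t
  rw [innerX_add_left hu htv (hu.add htv), innerX_smul_left, innerX_comm s u, innerX_comm s v,
    innerX_add_left hu htv hu, innerX_add_left hu htv hv, innerX_smul_left, innerX_smul_left,
    innerX_comm s v u]
  ring

lemma innerX_smul_smul (s c : ℝ) (u : EuclideanSpace ℝ (Fin N) → ℝ) :
    innerX s (c • u) (c • u) = c ^ 2 * innerX s u u := by
  rw [innerX_smul_left, innerX_comm, innerX_smul_left]; ring

lemma innerX_self_nonneg (hs0 : 0 < s) (hs1 : s < 1) (u : EuclideanSpace ℝ (Fin N) → ℝ) :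
    0 ≤ innerX s u u :=
  mul_nonneg (by have := fracConst_pos (N := N) hs0 hs1; positivity)
    (integral_nonneg (gagliardoKernel_self_nonneg s u))

lemma innerX_abs_le (hs0 : 0 < s) (hs1 : s < 1) (hu : MemX s Ω u) :
    innerX s (fun x => |u x|) (fun x => |u x|) ≤ innerX s u u := by
  have := fracConst_pos (N := N) hs0 hs1
  refine mul_le_mul_of_nonneg_left ?_ (by positivity)
  refine integral_mono hu.abs.finite_seminorm hu.finite_seminorm fun z => ?_
  simp only [gagliardoKernel]
  refine div_le_div_of_nonneg_right ?_ (by positivity)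
  rw [← abs_mul_abs_self (|u _| - _), ← abs_mul_abs_self (u _ - _)]
  exact mul_self_le_mul_self (abs_nonneg _) (abs_abs_sub_abs_le_abs_sub _ _)

lemma innerX_truncate_le (hs0 : 0 < s) (hs1 : s < 1) (hu : MemX s Ω u) {M : ℝ} (hM : 0 ≤ M) :
    innerX s (fun x => max (-M) (min (u x) M)) (fun x => max (-M) (min (u x) M)) ≤
      innerX s u u := by
  have := fracConst_pos (N := N) hs0 hs1
  refine mul_le_mul_of_nonneg_left ?_ (by positivity)
  refine integral_mono (hu.truncate hM).finite_seminorm hu.finite_seminorm fun z => ?_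
  simp only [gagliardoKernel]
  refine div_le_div_of_nonneg_right ?_ (by positivity)
  rw [← abs_mul_abs_self (max _ _ - _), ← abs_mul_abs_self (u _ - _)]
  exact mul_self_le_mul_self (abs_nonneg _) (by grind)

end InnerX

/-! ### An element of $X(\Omega)$ positive throughout $\Omega$ -/

section DistanceFunction

/-- The distance to the complement of `Ω`. -/
def distCompl (Ω : Set (EuclideanSpace ℝ (Fin N))) (x : EuclideanSpace ℝ (Fin N)) : ℝ :=
  Metric.infDist x Ωᶜ

/-- In polar coordinates the integrand is $t^{1-2s}$ on $(0,1]$, integrable since $s<1$, and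
$t^{-1-2s}$ beyond, integrable since $s>0$. -/
lemma integrable_min_div_norm_rpow (hN : 0 < N) (hs0 : 0 < s) (hs1 : s < 1) :
    Integrable (fun z : EuclideanSpace ℝ (Fin N) =>
      min (‖z‖ ^ 2) 1 / ‖z‖ ^ ((N : ℝ) + 2 * s)) := by
  have : Nonempty (Fin N) := ⟨⟨0, hN⟩⟩
  refine (integrable_fun_norm_addHaar volume
    (f := fun t : ℝ => min (t ^ 2) 1 / t ^ ((N : ℝ) + 2 * s))).2 ?_
  have hdim : Module.finrank ℝ (EuclideanSpace ℝ (Fin N)) = N := by simp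
  rw [hdim, ← Set.Ioc_union_Ioi_eq_Ioi zero_le_one]
  have key : ∀ t : ℝ, 0 < t → t ^ (N - 1) / t ^ ((N : ℝ) + 2 * s) = t ^ (-1 - 2 * s) := by
    intro t ht
    rw [← Real.rpow_natCast t, ← Real.rpow_sub ht, Nat.cast_sub hN]
    congr 1; push_cast; ring
  refine IntegrableOn.union ?_ ?_
  · have h1 : IntegrableOn (fun t : ℝ => t ^ (1 - 2 * s)) (Set.Ioc 0 1) := by
      rw [← intervalIntegrable_iff_integrableOn_Ioc_of_le zero_le_one]
      exact intervalIntegral.intervalIntegrable_rpow' (by linarith)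
    refine h1.congr_fun (fun t ht => ?_) measurableSet_Ioc
    have ht0 : 0 < t := ht.1
    have : min (t ^ 2) 1 = t ^ 2 := min_eq_left (by nlinarith [ht.2])
    simp only [this, smul_eq_mul]
    rw [show t ^ (N - 1) * (t ^ 2 / t ^ ((N : ℝ) + 2 * s)) =
      t ^ 2 * (t ^ (N - 1) / t ^ ((N : ℝ) + 2 * s)) by ring, key t ht0, ← Real.rpow_natCast t 2,
      ← Real.rpow_add ht0]
    congr 1; push_cast; ring
  · have h1 : IntegrableOn (fun t : ℝ => t ^ (-1 - 2 * s)) (Set.Ioi 1) :=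
      integrableOn_Ioi_rpow_of_lt (by linarith) one_pos
    refine h1.congr_fun (fun t ht => ?_) measurableSet_Ioi
    have ht1 : 1 < t := ht
    have : min (t ^ 2) 1 = 1 := min_eq_right (by nlinarith)
    simp only [this, smul_eq_mul]
    rw [← key t (by linarith)]; ring

/-- With $R\ge1$, the one constant $R^2$ serves both the Lipschitz bound and the sup bound on
squared differences. -/
lemma exists_distCompl_le (hN : 0 < N) (hΩ_bdd : Bornology.IsBounded Ω) :
    ∃ R : ℝ, 1 ≤ R ∧ ∀ x, distCompl Ω x ≤ R := by
  have : Nonempty (Fin N) := ⟨⟨0, hN⟩⟩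
  obtain ⟨R, hR⟩ := hΩ_bdd.subset_closedBall 0
  obtain ⟨y, hy⟩ : ∃ y : EuclideanSpace ℝ (Fin N), max R 0 + 1 = ‖y‖ := by
    obtain ⟨y, hy⟩ := exists_norm_eq (EuclideanSpace ℝ (Fin N)) (c := max R 0 + 1) (by positivity)
    exact ⟨y, hy.symm⟩
  have hyΩ : y ∈ Ωᶜ := fun h => by
    have := hR h
    simp only [Metric.mem_closedBall, dist_zero_right] at this
    linarith [le_max_left R 0]
  refine ⟨2 * (max R 0 + 1), by linarith [le_max_right R 0], fun x => ?_⟩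
  by_cases hx : x ∈ Ω
  · refine (Metric.infDist_le_dist_of_mem hyΩ).trans ?_
    have := hR hx
    simp only [Metric.mem_closedBall, dist_zero_right] at this
    rw [dist_eq_norm]
    linarith [norm_sub_le x y, le_max_left R 0]
  · rw [distCompl, Metric.infDist_zero_of_mem hx]
    linarith [le_max_right R 0]

lemma distCompl_nonneg (x : EuclideanSpace ℝ (Fin N)) : 0 ≤ distCompl Ω x := Metric.infDist_nonneg

lemma distCompl_pos (hN : 0 < N) (hΩ_open : IsOpen Ω) (hΩ_bdd : Bornology.IsBounded Ω)
    {x : EuclideanSpace ℝ (Fin N)} (hx : x ∈ Ω) : 0 < distCompl Ω x := by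
  have : Nonempty (Fin N) := ⟨⟨0, hN⟩⟩
  have hne : (Ωᶜ).Nonempty := by
    rw [Set.nonempty_compl]
    rintro rfl
    exact NormedSpace.unbounded_univ ℝ (EuclideanSpace ℝ (Fin N)) hΩ_bdd
  exact (hΩ_open.isClosed_compl.notMem_iff_infDist_pos hne).1 (by simpa using hx)

/-- The distance function is bounded and 1-Lipschitz, so no regularity of $\partial\Omega$ is
needed. It serves to show that suprema are positive and as the barrier in the maximum principle. -/
lemma memX_distCompl (hN : 0 < N) (hs0 : 0 < s) (hs1 : s < 1) (hΩ_open : IsOpen Ω)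
    (hΩ_bdd : Bornology.IsBounded Ω) : MemX s Ω (distCompl Ω) := by
  obtain ⟨R, hR1, hR⟩ := exists_distCompl_le hN hΩ_bdd
  have hm : Measurable (distCompl Ω) := (Metric.continuous_infDist_pt _).measurable
  have h0 : ∀ x, x ∉ Ω → distCompl Ω x = 0 := fun x hx => Metric.infDist_zero_of_mem hx
  have hvol : volume Ω ≠ ⊤ := hΩ_bdd.measure_lt_top.ne
  have hind : Integrable (Ω.indicator (fun _ => (1 : ℝ))) :=
    (integrable_indicator_iff hΩ_open.measurableSet).2 (integrableOn_const hvol)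
  have hg := integrable_min_div_norm_rpow hN hs0 hs1
  -- The function $1_\Omega(y)\min(|x-y|^2,1)/|x-y|^{N+2s}$ is integrable on the product. Together
  -- with its swap it dominates the kernel, which vanishes when neither point lies in $\Omega$.
  have hconv := hind.convolution_integrand (ContinuousLinearMap.mul ℝ ℝ) hg
  refine ⟨?_, ?_, .of_forall h0⟩
  · have h2 : MemLp (Ω.indicator (fun _ => R)) 2 volume :=
      memLp_indicator_const 2 hΩ_open.measurableSet R (.inr hvol)
    refine h2.mono' hm.aestronglyMeasurable (.of_forall fun x => ?_)
    rw [Real.norm_of_nonneg (distCompl_nonneg x)]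
    by_cases hx : x ∈ Ω
    · simpa [hx] using hR x
    · simp [hx, h0 x hx]
  · refine ((hconv.add hconv.swap).const_mul (R ^ 2)).mono'
      (aestronglyMeasurable_gagliardoKernel s hm.aestronglyMeasurable hm.aestronglyMeasurable)
      (.of_forall fun z => ?_)
    rw [Real.norm_of_nonneg (gagliardoKernel_self_nonneg s _ z)]
    obtain ⟨x, y⟩ := z
    simp only [gagliardoKernel, Pi.add_apply, Function.comp_apply, Prod.swap_prod_mk,
      ContinuousLinearMap.mul_apply', norm_sub_rev y x]
    rw [← add_mul, ← mul_div_assoc, ← mul_div_assoc]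
    refine div_le_div_of_nonneg_right ?_ (by positivity)
    have hlip : |distCompl Ω x - distCompl Ω y| ≤ ‖x - y‖ := by
      have := (Metric.lipschitz_infDist_pt Ωᶜ).dist_le_mul x y
      simpa [Real.dist_eq, dist_eq_norm, distCompl] using this
    have hbd : |distCompl Ω x - distCompl Ω y| ≤ R :=
      abs_le.2 ⟨by linarith [hR y, distCompl_nonneg (Ω := Ω) x],
        by linarith [hR x, distCompl_nonneg (Ω := Ω) y]⟩
    rw [← abs_mul_abs_self]
    have hmin : |distCompl Ω x - distCompl Ω y| * |distCompl Ω x - distCompl Ω y| ≤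
        R ^ 2 * min (‖x - y‖ ^ 2) 1 := by
      rw [mul_min_of_nonneg _ _ (by positivity)]
      have := abs_nonneg (distCompl Ω x - distCompl Ω y)
      have hn := norm_nonneg (x - y)
      refine le_min ?_ ?_
      · have h3 : 1 * ‖x - y‖ ^ 2 ≤ R ^ 2 * ‖x - y‖ ^ 2 :=
          mul_le_mul_of_nonneg_right (by nlinarith) (by positivity)
        nlinarith [mul_self_le_mul_self this hlip]
      · nlinarith
    by_cases hx : x ∈ Ω
    · by_cases hy : y ∈ Ω
      · simp only [hx, hy, Set.indicator_of_mem]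
        nlinarith [show 0 ≤ R ^ 2 * min (‖x - y‖ ^ 2) 1 by positivity]
      · simpa [hx, hy] using hmin
    · by_cases hy : y ∈ Ω
      · simpa [hx, hy] using hmin
      · simp [hx, hy, h0]

end DistanceFunction

/-! ### Ball means and the fractional Sobolev inequality -/

/-- Fatou's lemma for Bochner integrals of nonnegative functions. -/
lemma integral_le_of_tendsto_of_eventually_le {α : Type*} [MeasurableSpace α] {μ : Measure α}
    {F : ℕ → α → ℝ} {G : α → ℝ} {B : ℝ} (hF : ∀ n, Integrable (F n) μ) (h0 : ∀ n x, 0 ≤ F n x)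
    (hG : ∀ᵐ x ∂μ, Tendsto (fun n => F n x) atTop (𝓝 (G x)))
    (hB : ∀ᶠ n in atTop, ∫ x, F n x ∂μ ≤ B) : Integrable G μ ∧ ∫ x, G x ∂μ ≤ B := by
  have hGm : AEStronglyMeasurable G μ := aestronglyMeasurable_of_tendsto_ae atTop
    (fun n => (hF n).1) hG
  have hG0 : 0 ≤ᵐ[μ] G := by
    filter_upwards [hG] with x hx
    exact ge_of_tendsto' hx fun n => h0 n x
  have hBn : 0 ≤ B := by
    obtain ⟨n, hn⟩ := hB.exists
    exact (integral_nonneg (h0 n)).trans hn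
  have key : ∫⁻ x, ENNReal.ofReal (G x) ∂μ ≤ ENNReal.ofReal B := by
    calc ∫⁻ x, ENNReal.ofReal (G x) ∂μ
        = ∫⁻ x, liminf (fun n => ENNReal.ofReal (F n x)) atTop ∂μ := by
          refine lintegral_congr_ae ?_
          filter_upwards [hG] with x hx
          exact ((ENNReal.continuous_ofReal.tendsto _).comp hx).liminf_eq.symm
      _ ≤ liminf (fun n => ∫⁻ x, ENNReal.ofReal (F n x) ∂μ) atTop :=
          lintegral_liminf_le' fun n => (hF n).1.aemeasurable.ennreal_ofReal
      _ ≤ ENNReal.ofReal B := by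
          refine liminf_le_of_frequently_le' (Eventually.frequently ?_)
          filter_upwards [hB] with n hn
          rw [← ofReal_integral_eq_lintegral_ofReal (hF n) (.of_forall (h0 n))]
          exact ENNReal.ofReal_le_ofReal hn
  have hGi : Integrable G μ := by
    refine ⟨hGm, ?_⟩
    rw [hasFiniteIntegral_iff_ofReal hG0]
    exact key.trans_lt ENNReal.ofReal_lt_top
  refine ⟨hGi, ?_⟩
  rw [← ofReal_integral_eq_lintegral_ofReal hGi hG0] at key
  exact (ENNReal.ofReal_le_ofReal_iff hBn).1 key

/-- Cauchy–Schwarz against $1$, read off from $\int (VF-I)^2\ge 0$ with $V$ the total mass and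
$I=\int F$. -/
lemma sq_integral_le_measureReal_mul_integral_sq {α : Type*} [MeasurableSpace α] {μ : Measure α}
    [IsFiniteMeasure μ] {F : α → ℝ} (hF : MemLp F 2 μ) :
    (∫ x, F x ∂μ) ^ 2 ≤ μ.real Set.univ * ∫ x, F x ^ 2 ∂μ := by
  have h1 : Integrable F μ := hF.integrable one_le_two
  have h2 : Integrable (fun x => F x ^ 2) μ := hF.integrable_sq
  set V := μ.real Set.univ
  set I := ∫ x, F x ∂μ
  have key : 0 ≤ ∫ x, (V * F x - I) ^ 2 ∂μ := integral_nonneg fun x => sq_nonneg _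
  have hexp : ∫ x, (V * F x - I) ^ 2 ∂μ = V * (V * (∫ x, F x ^ 2 ∂μ) - I ^ 2) := by
    have : ∀ x, (V * F x - I) ^ 2 = V ^ 2 * F x ^ 2 - 2 * V * I * F x + I ^ 2 := fun x => by ring
    simp_rw [this]
    rw [integral_add (f := fun x => V ^ 2 * F x ^ 2 - 2 * V * I * F x) (g := fun _ => I ^ 2)
        ((h2.const_mul _).sub (h1.const_mul _)) (integrable_const _),
      integral_sub (h2.const_mul _) (h1.const_mul _), integral_const_mul, integral_const_mul,
      integral_const, smul_eq_mul]
    ring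
  rw [hexp] at key
  rcases (measureReal_nonneg : 0 ≤ V).eq_or_lt with h | h
  · have hμ : μ = 0 := by
      rw [← Measure.measure_univ_eq_zero]
      exact (measureReal_eq_zero_iff).1 h.symm
    simp [I, hμ]
  · nlinarith [nonneg_of_mul_nonneg_right key h]

/-- The volume of the unit ball. -/
def unitBallVolume (N : ℕ) : ℝ := (volume : Measure (EuclideanSpace ℝ (Fin N))).real
  (Metric.ball 0 1)

lemma unitBallVolume_pos : 0 < unitBallVolume N :=
  ENNReal.toReal_pos (Metric.measure_ball_pos _ _ one_pos).ne'
    measure_ball_lt_top.ne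

lemma volume_real_ball (x : EuclideanSpace ℝ (Fin N)) {h : ℝ} (hh : 0 < h) :
    (volume : Measure (EuclideanSpace ℝ (Fin N))).real (Metric.ball x h) =
      h ^ N * unitBallVolume N := by
  rw [unitBallVolume, Measure.real_def, Measure.real_def, Measure.addHaar_ball_of_pos _ _ hh,
    ENNReal.toReal_mul, ENNReal.toReal_ofReal (by positivity)]
  simp

/-- The mean of `f` over the ball of radius `h` about `x`. -/
def ballMean (h : ℝ) (f : EuclideanSpace ℝ (Fin N) → ℝ) (x : EuclideanSpace ℝ (Fin N)) : ℝ :=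
  (h ^ N * unitBallVolume N)⁻¹ * ∫ y in Metric.ball x h, f y

/-- The density `x ↦ ∫ |f(x)-f(y)|² / |x-y|^(N+2s) dy` of the Gagliardo energy. -/
def energyDensity (s : ℝ) (f : EuclideanSpace ℝ (Fin N) → ℝ) (x : EuclideanSpace ℝ (Fin N)) : ℝ :=
  ∫ y, gagliardoKernel s f f (x, y)

lemma energyDensity_nonneg (x : EuclideanSpace ℝ (Fin N)) : 0 ≤ energyDensity s f x :=
  integral_nonneg fun _ => gagliardoKernel_self_nonneg s f _

lemma MemX.integrable_energyDensity (hf : MemX s Ω f) : Integrable (energyDensity s f) :=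
  hf.finite_seminorm.integral_prod_left

lemma MemX.integral_energyDensity (hf : MemX s Ω f) :
    fracConst N s / 2 * ∫ x, energyDensity s f x = innerX s f f := by
  rw [innerX, integral_prod _ hf.finite_seminorm]; rfl

lemma MemX.integral_energyDensity_eq (hs0 : 0 < s) (hs1 : s < 1) (hf : MemX s Ω f) :
    ∫ x, energyDensity s f x = 2 / fracConst N s * innerX s f f := by
  have := fracConst_pos (N := N) hs0 hs1
  rw [← hf.integral_energyDensity]; field_simp

/-- Cauchy–Schwarz on the ball, then $|x-y|^{N+2s}\le h^{N+2s}$ there; the factor $h^N$ cancels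
against the volume. By Fubini, `hx` holds at almost every $x$ when $f\in X(\Omega)$. -/
lemma sq_sub_ballMean_le (hs0 : 0 < s) (hf : MemLp f 2 volume) {x : EuclideanSpace ℝ (Fin N)}
    (hx : Integrable fun y => gagliardoKernel s f f (x, y)) {h : ℝ} (hh : 0 < h) :
    (f x - ballMean h f x) ^ 2 ≤ (unitBallVolume N)⁻¹ * h ^ (2 * s) * energyDensity s f x := by
  have hω := unitBallVolume_pos (N := N)
  set B := Metric.ball x h
  have : IsFiniteMeasure (volume.restrict B) := ⟨by
    rw [Measure.restrict_apply_univ]; exact measure_ball_lt_top⟩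
  have hV : (volume.restrict B).real Set.univ = h ^ N * unitBallVolume N := by
    rw [measureReal_restrict_apply MeasurableSet.univ, Set.univ_inter, volume_real_ball x hh]
  have hfB : MemLp f 2 (volume.restrict B) := hf.restrict B
  have hdB : MemLp (fun y => f x - f y) 2 (volume.restrict B) := (memLp_const (f x)).sub hfB
  have hint : ∫ y in B, (f x - f y) = h ^ N * unitBallVolume N * (f x - ballMean h f x) := by
    rw [integral_sub (integrable_const _) (hfB.integrable one_le_two), integral_const, hV,
      smul_eq_mul, ballMean]
    field_simp
    rfl
  have h1 := sq_integral_le_measureReal_mul_integral_sq hdB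
  have h2 : ∫ y in B, (f x - f y) ^ 2 ≤ h ^ ((N : ℝ) + 2 * s) * energyDensity s f x := by
    rw [energyDensity, ← integral_const_mul]
    refine le_trans (setIntegral_mono_on hdB.integrable_sq (hx.const_mul _).integrableOn
      measurableSet_ball fun y hy => ?_) (setIntegral_le_integral (hx.const_mul _)
        (.of_forall fun y => mul_nonneg (by positivity) (gagliardoKernel_self_nonneg s f _)))
    simp only [gagliardoKernel]
    rcases (norm_nonneg (x - y)).eq_or_lt with h0 | h0
    · have : x = y := sub_eq_zero.1 (norm_eq_zero.1 h0.symm)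
      simp [this]
    · rw [← mul_div_assoc, le_div_iff₀ (by positivity), ← sq, mul_comm]
      refine mul_le_mul_of_nonneg_right (Real.rpow_le_rpow h0.le ?_ (by positivity)) (sq_nonneg _)
      rw [← dist_eq_norm, dist_comm]
      exact (Metric.mem_ball.1 hy).le
  rw [hint, hV] at h1
  have hpow : h ^ ((N : ℝ) + 2 * s) = h ^ N * h ^ (2 * s) := by
    rw [Real.rpow_add hh, Real.rpow_natCast]
  rw [hpow] at h2
  have hVp : 0 < h ^ N * unitBallVolume N := by positivity
  have h3 : (h ^ N * unitBallVolume N) * (f x - ballMean h f x) ^ 2 ≤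
      h ^ N * h ^ (2 * s) * energyDensity s f x := by
    refine le_of_mul_le_mul_left ?_ hVp
    calc _ = (h ^ N * unitBallVolume N * (f x - ballMean h f x)) ^ 2 := by ring
      _ ≤ _ := h1.trans (mul_le_mul_of_nonneg_left h2 hVp.le)
  have hhN : 0 < h ^ N := by positivity
  rw [mul_assoc, inv_mul_eq_div, le_div_iff₀ hω]
  refine le_of_mul_le_mul_left ?_ hhN
  calc _ = (h ^ N * unitBallVolume N) * (f x - ballMean h f x) ^ 2 := by ring
    _ ≤ _ := h3
    _ = _ := by ring

/-- Jensen's inequality on the ball, followed by enlarging the domain of integration. -/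
lemma abs_ballMean_rpow_le {q : ℝ} (hq : 1 ≤ q) (hf : MemLp f 2 volume)
    (hfq : Integrable fun x => |f x| ^ q) (x : EuclideanSpace ℝ (Fin N)) {h : ℝ} (hh : 0 < h) :
    |ballMean h f x| ^ q ≤ (h ^ N * unitBallVolume N)⁻¹ * ∫ y, |f y| ^ q := by
  have hω := unitBallVolume_pos (N := N)
  set B := Metric.ball x h
  have hVp : 0 < h ^ N * unitBallVolume N := by positivity
  have hV : (volume : Measure (EuclideanSpace ℝ (Fin N))).real B = h ^ N * unitBallVolume N :=
    volume_real_ball x hh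
  have : IsFiniteMeasure (volume.restrict B) := ⟨by
    rw [Measure.restrict_apply_univ]; exact measure_ball_lt_top⟩
  have hfB : Integrable f (volume.restrict B) := (hf.restrict B).integrable one_le_two
  have h1 : |ballMean h f x| ≤ ⨍ y in B, |f y| := by
    rw [setAverage_eq, hV, smul_eq_mul, ballMean, abs_mul, abs_of_pos (inv_pos.2 hVp)]
    exact mul_le_mul_of_nonneg_left abs_integral_le_integral_abs (inv_pos.2 hVp).le
  have h2 : (⨍ y in B, |f y|) ^ q ≤ ⨍ y in B, |f y| ^ q := by
    refine (convexOn_rpow hq).map_set_average_le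
      (Real.continuous_rpow_const (by linarith)).continuousOn isClosed_Ici
      (Metric.measure_ball_pos _ _ hh).ne' measure_ball_lt_top.ne
      (.of_forall fun y => Set.mem_Ici.2 (abs_nonneg _)) hfB.abs hfq.integrableOn
  refine (Real.rpow_le_rpow (abs_nonneg _) h1 (by linarith)).trans (h2.trans ?_)
  rw [setAverage_eq, hV, smul_eq_mul]
  refine mul_le_mul_of_nonneg_left (setIntegral_le_integral hfq ?_) (inv_pos.2 hVp).le
  exact .of_forall fun y => by positivity

lemma critExp_gt_two (hs0 : 0 < s) (hN : 2 * s < (N : ℝ)) : 2 < critExp N s := by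
  rw [critExp, lt_div_iff₀ (by linarith)]; linarith

lemma critExp_identity (hN : 2 * s < (N : ℝ)) (hs0 : 0 < s) :
    critExp N s * (2 * s / N) = critExp N s - 2 := by
  have h1 : (N : ℝ) - 2 * s ≠ 0 := by linarith
  have h2 : (N : ℝ) ≠ 0 := by linarith
  rw [critExp]; field_simp; ring

/-- The constant of the pointwise form of the fractional Sobolev inequality. -/
def sobolevConst (N : ℕ) (s : ℝ) : ℝ :=
  4 * (unitBallVolume N)⁻¹ * (2 ^ critExp N s / unitBallVolume N) ^ (2 * s / N)

lemma sobolevConst_pos : 0 < sobolevConst N s := by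
  have := unitBallVolume_pos (N := N)
  unfold sobolevConst; positivity

/-- The radius is taken so large that the mean is at most $|f(x)|/2$; then $|f(x)|^2/4\le
\omega^{-1}h^{2s}D(x)$. By `critExp_identity` this $h^{2s}$ is a constant times
$K^{2s/N}|f(x)|^{-(2^*_s-2)}$, where $K=\int|f|^{2^*_s}$. -/
lemma abs_rpow_critExp_le (hs0 : 0 < s) (hN : 2 * s < (N : ℝ)) (hf : MemLp f 2 volume)
    (hfq : Integrable fun x => |f x| ^ critExp N s) {x : EuclideanSpace ℝ (Fin N)}
    (hx : Integrable fun y => gagliardoKernel s f f (x, y)) :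
    |f x| ^ critExp N s ≤
      sobolevConst N s * (∫ y, |f y| ^ critExp N s) ^ (2 * s / N) * energyDensity s f x := by
  have hω := unitBallVolume_pos (N := N)
  have hq := critExp_gt_two hs0 hN
  have hid := critExp_identity hN hs0
  have hC := sobolevConst_pos (N := N) (s := s)
  set q := critExp N s
  set K := ∫ y, |f y| ^ q
  have hN0 : (0 : ℝ) < N := by linarith
  have hK0 : 0 ≤ K := integral_nonneg fun y => by positivity
  have hD := energyDensity_nonneg (s := s) (f := f) x
  rcases (abs_nonneg (f x)).eq_or_lt with h0 | h0
  · rw [← h0, Real.zero_rpow (by linarith)]; positivity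
  rcases hK0.eq_or_lt with hK | hK
  -- If $K=0$ every mean vanishes, and $h\to0$ in the oscillation bound contradicts $f(x)\ne0$.
  · have hA : ∀ h : ℝ, 0 < h → ballMean h f x = 0 := fun h hh => by
      have := abs_ballMean_rpow_le (by linarith : 1 ≤ q) hf hfq x hh
      rw [show ∫ y, |f y| ^ q = K from rfl, ← hK, mul_zero] at this
      have h1 := le_antisymm this (by positivity)
      rw [Real.rpow_eq_zero (abs_nonneg _) (by linarith)] at h1
      exact abs_eq_zero.1 h1
    have hle : ∀ h : ℝ, 0 < h → f x ^ 2 ≤ (unitBallVolume N)⁻¹ * h ^ (2 * s) * energyDensity s f x :=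
      fun h hh => by simpa [hA h hh] using sq_sub_ballMean_le hs0 hf hx hh
    have hlim : Tendsto (fun h : ℝ => (unitBallVolume N)⁻¹ * h ^ (2 * s) * energyDensity s f x) (𝓝[>] 0)
        (𝓝 ((unitBallVolume N)⁻¹ * 0 ^ (2 * s) * energyDensity s f x)) := by
      refine Tendsto.mul_const _ (Tendsto.const_mul _ ?_)
      exact ((Real.continuous_rpow_const (by linarith)).tendsto 0).mono_left nhdsWithin_le_nhds
    have := ge_of_tendsto hlim (eventually_nhdsWithin_of_forall hle)
    rw [Real.zero_rpow (by linarith), mul_zero, zero_mul] at this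
    have h2 : 0 < f x ^ 2 := by rw [← sq_abs]; positivity
    linarith
  -- $Y=h^N$ is the value at which the Jensen bound for the mean equals $(|f(x)|/2)^q$.
  · set Y := 2 ^ q * K / (unitBallVolume N * |f x| ^ q) with hY
    have hYp : 0 < Y := by positivity
    set h := Y ^ (1 / (N : ℝ)) with hh_def
    have hh : 0 < h := by positivity
    have hhN : h ^ N = Y := by
      rw [← Real.rpow_natCast, hh_def, ← Real.rpow_mul hYp.le, one_div_mul_cancel hN0.ne',
        Real.rpow_one]
    have hhs : h ^ (2 * s) = Y ^ (2 * s / N) := by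
      rw [hh_def, ← Real.rpow_mul hYp.le]; congr 1; ring
    have hA : |ballMean h f x| ≤ |f x| / 2 := by
      have h1 := abs_ballMean_rpow_le (by linarith : 1 ≤ q) hf hfq x hh
      rw [show ∫ y, |f y| ^ q = K from rfl, hhN] at h1
      refine (Real.rpow_le_rpow_iff (abs_nonneg _) (by positivity)
        (by linarith : 0 < q)).1 (h1.trans_eq ?_)
      rw [Real.div_rpow h0.le (by norm_num), hY]
      field_simp
    have h2 := sq_sub_ballMean_le hs0 hf hx hh
    have h3 : |f x| ^ 2 / 4 ≤ (f x - ballMean h f x) ^ 2 := by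
      have : |f x| / 2 ≤ |f x - ballMean h f x| := by
        linarith [abs_sub_abs_le_abs_sub (f x) (ballMean h f x)]
      rw [← sq_abs (f x - _)]
      nlinarith
    have h4 : Y ^ (2 * s / N) = (2 ^ q / unitBallVolume N) ^ (2 * s / N) * K ^ (2 * s / N) / |f x| ^ (q - 2) := by
      rw [← hid, Real.rpow_mul h0.le, ← Real.mul_rpow (by positivity) hK.le,
        ← Real.div_rpow (by positivity) (by positivity), hY]
      congr 1; field_simp
    rw [hhs, h4] at h2
    have h5 : |f x| ^ q = |f x| ^ 2 * |f x| ^ (q - 2) := by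
      rw [← Real.rpow_natCast, ← Real.rpow_add h0]; congr 1; push_cast; ring
    have h6 : 0 < |f x| ^ (q - 2) := by positivity
    rw [h5]
    calc |f x| ^ 2 * |f x| ^ (q - 2)
        ≤ 4 * ((unitBallVolume N)⁻¹ * ((2 ^ q / unitBallVolume N) ^ (2 * s / N) * K ^ (2 * s / N) / |f x| ^ (q - 2)) *
            energyDensity s f x) * |f x| ^ (q - 2) :=
          mul_le_mul_of_nonneg_right (by linarith) h6.le
      _ = _ := by
          rw [sobolevConst, show critExp N s = q from rfl]; field_simp

/-- Integrating the pointwise bound gives $K\le C K^{2s/N}E$, with $E$ the integral of the energy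
density, and $2s/N=1-2/2^*_s$. Cancelling $K^{2s/N}$ needs $K$ finite, whence the integrability
hypothesis. -/
lemma integral_rpow_critExp_le_of_integrable (hs0 : 0 < s) (hs1 : s < 1) (hN : 2 * s < (N : ℝ))
    (hf : MemX s Ω f) (hfq : Integrable fun x => |f x| ^ critExp N s) :
    ∫ x, |f x| ^ critExp N s ≤
      (sobolevConst N s * (2 / fracConst N s * innerX s f f)) ^ (critExp N s / 2) := by
  have hq := critExp_gt_two hs0 hN
  have hid := critExp_identity hN hs0
  have hC := sobolevConst_pos (N := N) (s := s)
  have hF := fracConst_pos (N := N) hs0 hs1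
  have hE := innerX_self_nonneg hs0 hs1 f
  have h1 : ∫ x, |f x| ^ critExp N s ≤ sobolevConst N s *
      (∫ y, |f y| ^ critExp N s) ^ (2 * s / N) * ∫ x, energyDensity s f x := by
    rw [← integral_const_mul]
    refine integral_mono_ae hfq (hf.integrable_energyDensity.const_mul _) ?_
    filter_upwards [hf.finite_seminorm.prod_right_ae] with x hx
    exact abs_rpow_critExp_le hs0 hN hf.memLp hfq hx
  rw [hf.integral_energyDensity_eq hs0 hs1] at h1
  set K := ∫ y, |f y| ^ critExp N s
  have hK0 : 0 ≤ K := integral_nonneg fun y => by positivity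
  rcases hK0.eq_or_lt with hK | hK
  · rw [← hK]; positivity
  have h2 : K ^ (2 / critExp N s) ≤ sobolevConst N s * (2 / fracConst N s * innerX s f f) := by
    have h3 : K = K ^ (2 / critExp N s) * K ^ (2 * s / N) := by
      rw [← Real.rpow_add hK]
      have : 2 / critExp N s + 2 * s / N = 1 := by
        have hne : critExp N s ≠ 0 := by linarith
        rw [show 2 * s / N = (critExp N s - 2) / critExp N s by
          rw [eq_div_iff hne]; linarith]
        field_simp; ring
      rw [this, Real.rpow_one]
    have h4 : 0 < K ^ (2 * s / N) := by positivity
    refine le_of_mul_le_mul_right ?_ h4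
    rw [← h3]
    refine h1.trans_eq (by ring)
  calc K = (K ^ (2 / critExp N s)) ^ (critExp N s / 2) := by
        rw [← Real.rpow_mul hK.le, div_mul_div_cancel₀ (by linarith : critExp N s ≠ 0),
          div_self two_ne_zero, Real.rpow_one]
    _ ≤ _ := Real.rpow_le_rpow (by positivity) h2 (by linarith)

/-- The fractional Sobolev inequality. -/
lemma MemX.integral_rpow_critExp_le (hs0 : 0 < s) (hs1 : s < 1) (hN : 2 * s < (N : ℝ))
    (hf : MemX s Ω f) : Integrable (fun x => |f x| ^ critExp N s) ∧ ∫ x, |f x| ^ critExp N s ≤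
      (sobolevConst N s * (2 / fracConst N s * innerX s f f)) ^ (critExp N s / 2) := by
  have hq := critExp_gt_two hs0 hN
  have hC := sobolevConst_pos (N := N) (s := s)
  have hF := fracConst_pos (N := N) hs0 hs1
  -- Truncations are bounded and in $L^2$, hence in $L^{2^*_s}$. Their energy does not exceed that
  -- of $f$, so the bound is uniform in the level and Fatou removes the truncation.
  set T : ℕ → EuclideanSpace ℝ (Fin N) → ℝ := fun M x => max (-(M : ℝ)) (min (f x) M)
  have hT : ∀ M, MemX s Ω (T M) := fun M => hf.truncate M.cast_nonneg
  have hTb : ∀ M x, |T M x| ≤ M := fun M x => by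
    have : (0 : ℝ) ≤ M := M.cast_nonneg
    simp only [T, abs_le]; grind
  have hTi : ∀ M, Integrable fun x => |T M x| ^ critExp N s := fun M => by
    refine ((hT M).memLp.integrable_sq.const_mul ((M : ℝ) ^ (critExp N s - 2))).mono'
      ((hT M).aesm.norm.aemeasurable.pow_const _).aestronglyMeasurable (.of_forall fun x => ?_)
    rw [Real.norm_of_nonneg (by positivity)]
    rcases (abs_nonneg (T M x)).eq_or_lt with h0 | h0
    · rw [← h0, Real.zero_rpow (by linarith)]; positivity
    · have h5 : |T M x| ^ critExp N s = |T M x| ^ (critExp N s - 2) * T M x ^ 2 := by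
        rw [← sq_abs (T M x), ← Real.rpow_natCast, ← Real.rpow_add h0]; congr 1; push_cast; ring
      rw [h5]
      exact mul_le_mul_of_nonneg_right
        (Real.rpow_le_rpow h0.le (hTb M x) (by linarith)) (sq_nonneg _)
  refine integral_le_of_tendsto_of_eventually_le hTi (fun M x => by positivity)
    (.of_forall fun x => ?_) (.of_forall fun M => ?_)
  · obtain ⟨n, hn⟩ := exists_nat_ge |f x|
    refine tendsto_const_nhds.congr' ?_
    filter_upwards [eventually_ge_atTop n] with M hM
    have : |f x| ≤ M := hn.trans (by exact_mod_cast hM)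
    have h2 := abs_le.1 this
    have h3 : T M x = f x := by simp only [T]; rw [min_eq_left h2.2, max_eq_right h2.1]
    rw [h3]
  · refine (integral_rpow_critExp_le_of_integrable hs0 hs1 hN (hT M) (hTi M)).trans ?_
    refine Real.rpow_le_rpow ?_ ?_ (by linarith)
    · have := innerX_self_nonneg hs0 hs1 (T M)
      positivity
    · have := innerX_truncate_le hs0 hs1 hf (M := (M : ℝ)) M.cast_nonneg
      gcongr

/-- Each term dominates on its own side of $t=T$. For $r<q$ a large $T$ makes the top-order term
small, leaving the $L^2$ term to be controlled. -/
lemma rpow_le_add_rpow {r q t T : ℝ} (h2r : 2 ≤ r) (hrq : r ≤ q) (hT : 0 < T) (ht : 0 ≤ t) :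
    t ^ r ≤ T ^ (r - 2) * t ^ 2 + T ^ (r - q) * t ^ q := by
  rcases ht.eq_or_lt with rfl | ht
  · rw [Real.zero_rpow (by linarith)]; positivity
  rcases le_total t T with h | h
  · have : t ^ r = t ^ (r - 2) * t ^ 2 := by
      rw [← Real.rpow_natCast, ← Real.rpow_add ht]; congr 1; push_cast; ring
    rw [this]
    have h1 : t ^ (r - 2) ≤ T ^ (r - 2) := Real.rpow_le_rpow ht.le h (by linarith)
    have h2 : 0 ≤ T ^ (r - q) * t ^ q := by positivity
    nlinarith [sq_nonneg t]
  · have : t ^ r = t ^ (r - q) * t ^ q := by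
      rw [← Real.rpow_add ht]; congr 1; ring
    rw [this]
    have h1 : t ^ (r - q) ≤ T ^ (r - q) := Real.rpow_le_rpow_of_nonpos hT h (by linarith)
    have h2 : 0 ≤ T ^ (r - 2) * t ^ 2 := by positivity
    have h3 : 0 ≤ t ^ q := by positivity
    nlinarith

lemma MemX.integral_rpow_le (hs0 : 0 < s) (hs1 : s < 1) (hN : 2 * s < (N : ℝ))
    (hf : MemX s Ω f) {r : ℝ} (h2r : 2 ≤ r) (hr : r ≤ critExp N s) :
    Integrable (fun x => |f x| ^ r) ∧ ∀ T : ℝ, 0 < T →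
      ∫ x, |f x| ^ r ≤ T ^ (r - 2) * (∫ x, f x ^ 2) + T ^ (r - critExp N s) *
      (sobolevConst N s * (2 / fracConst N s * innerX s f f)) ^ (critExp N s / 2) := by
  obtain ⟨h1, h2⟩ := hf.integral_rpow_critExp_le hs0 hs1 hN
  have hsq := hf.memLp.integrable_sq
  have hle : ∀ T : ℝ, 0 < T → ∀ x, |f x| ^ r ≤
      T ^ (r - 2) * f x ^ 2 + T ^ (r - critExp N s) * |f x| ^ critExp N s := fun T hT x => by
    rw [← sq_abs (f x)]; exact rpow_le_add_rpow h2r hr hT (abs_nonneg _)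
  have hi : Integrable (fun x => |f x| ^ r) := by
    refine ((hsq.const_mul (1 ^ (r - 2))).add (h1.const_mul (1 ^ (r - critExp N s)))).mono'
      (hf.aesm.norm.aemeasurable.pow_const _).aestronglyMeasurable (.of_forall fun x => ?_)
    rw [Real.norm_of_nonneg (by positivity)]
    exact hle 1 one_pos x
  refine ⟨hi, fun T hT => ?_⟩
  calc ∫ x, |f x| ^ r
      ≤ ∫ x, (T ^ (r - 2) * f x ^ 2 + T ^ (r - critExp N s) * |f x| ^ critExp N s) :=
        integral_mono hi ((hsq.const_mul _).add (h1.const_mul _)) (hle T hT)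
    _ = T ^ (r - 2) * (∫ x, f x ^ 2) + T ^ (r - critExp N s) * ∫ x, |f x| ^ critExp N s := by
        rw [integral_add (hsq.const_mul _) (h1.const_mul _), integral_const_mul, integral_const_mul]
    _ ≤ _ := by gcongr

/-! ### Compactness of $X(\Omega)$ in subcritical Lebesgue spaces -/

lemma norm_toLp_sq {α : Type*} [MeasurableSpace α] {μ : Measure α} {F : α → ℝ}
    (hF : MemLp F 2 μ) : ‖hF.toLp F‖ ^ 2 = ∫ x, F x ^ 2 ∂μ := by
  rw [← real_inner_self_eq_norm_sq, L2.inner_def]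
  refine integral_congr_ae ?_
  filter_upwards [hF.coeFn_toLp] with x hx
  simp [hx, sq]

/-- A bounded sequence in a separable Hilbert space has a weakly convergent subsequence. -/
lemma exists_subseq_tendsto_inner {H : Type*} [NormedAddCommGroup H] [InnerProductSpace ℝ H]
    [CompleteSpace H] [TopologicalSpace.SeparableSpace H] {x : ℕ → H} {M : ℝ}
    (hx : ∀ n, ‖x n‖ ≤ M) : ∃ φ : ℕ → ℕ, StrictMono φ ∧ ∃ L : H → ℝ,
      ∀ y, Tendsto (fun n => inner ℝ y (x (φ n))) atTop (𝓝 (L y)) := by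
  obtain ⟨L, -, φ, hφ, hL⟩ := WeakDual.isSeqCompact_closedBall ℝ H (0 : StrongDual ℝ H) M
    (x := fun n => StrongDual.toWeakDual (innerSL ℝ (x n))) (fun n => by
      simp only [Set.mem_preimage, Metric.mem_closedBall, dist_zero_right]
      exact (innerSL_apply_norm ℝ (x n)).le.trans (hx n))
  refine ⟨φ, hφ, fun y => L y, fun y => ?_⟩
  have := ((WeakDual.eval_continuous y).tendsto L).comp hL
  refine this.congr fun n => ?_
  exact real_inner_comm _ _

lemma aestronglyMeasurable_ballMean (h : ℝ) (hf : AEStronglyMeasurable f volume) :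
    AEStronglyMeasurable (ballMean h f) volume := by
  have hS : MeasurableSet {z : EuclideanSpace ℝ (Fin N) × EuclideanSpace ℝ (Fin N) |
      dist z.2 z.1 < h} := measurableSet_lt (by fun_prop) measurable_const
  have h1 := ((hf.comp_snd (μ := volume)).indicator hS).integral_prod_right'
  refine AEStronglyMeasurable.congr (h1.const_mul (h ^ N * unitBallVolume N)⁻¹) (.of_forall fun x => ?_)
  simp only [ballMean]
  rw [← integral_indicator measurableSet_ball]
  rfl

lemma sq_ballMean_le (hf : MemLp f 2 volume) (x : EuclideanSpace ℝ (Fin N)) {h : ℝ} (hh : 0 < h) :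
    ballMean h f x ^ 2 ≤ (h ^ N * unitBallVolume N)⁻¹ * ∫ y, f y ^ 2 := by
  have := abs_ballMean_rpow_le one_le_two hf (by simpa using hf.integrable_sq) x hh
  simpa using this

lemma ballMean_sub (hf : MemLp f 2 volume) (hg : MemLp g 2 volume)
    (x : EuclideanSpace ℝ (Fin N)) (h : ℝ) :
    ballMean h (f - g) x = ballMean h f x - ballMean h g x := by
  have : IsFiniteMeasure (volume.restrict (Metric.ball x h)) := ⟨by
    rw [Measure.restrict_apply_univ]; exact measure_ball_lt_top⟩
  rw [ballMean, ballMean, ballMean, ← mul_sub]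
  congr 1
  exact integral_sub ((hf.restrict _).integrable one_le_two) ((hg.restrict _).integrable one_le_two)

lemma innerX_sub_le (hs0 : 0 < s) (hs1 : s < 1) (hu : MemX s Ω u) (hv : MemX s Ω v) :
    innerX s (u - v) (u - v) ≤ 2 * (innerX s u u + innerX s v v) := by
  have h1 := innerX_add_smul hu hv (-1)
  have h2 := innerX_add_smul hu hv 1
  have h3 := innerX_self_nonneg hs0 hs1 (u + (1 : ℝ) • v)
  rw [show u - v = u + (-1 : ℝ) • v by rw [neg_one_smul, sub_eq_add_neg], h1]
  rw [h2] at h3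
  linarith

/-- Comparison of the `L²` norm of `f ∈ X(Ω)` with that of its mean at scale `h`. -/
lemma MemX.integral_sq_le (hs0 : 0 < s) (hs1 : s < 1)
    (hΩ_bdd : Bornology.IsBounded Ω) (hf : MemX s Ω f) {h : ℝ} (hh : 0 < h) :
    ∫ x, f x ^ 2 ≤ 2 * ((unitBallVolume N)⁻¹ * h ^ (2 * s) * (2 / fracConst N s * innerX s f f)) +
      2 * ∫ x in Ω, ballMean h f x ^ 2 := by
  have hω := unitBallVolume_pos (N := N)
  have : IsFiniteMeasure (volume.restrict Ω) := ⟨by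
    rw [Measure.restrict_apply_univ]; exact hΩ_bdd.measure_lt_top⟩
  have h1 : ∫ x, f x ^ 2 = ∫ x in Ω, f x ^ 2 := by
    have := hf.setIntegral_eq f
    simp only [← sq] at this
    exact this.symm
  have hbi : IntegrableOn (fun x => ballMean h f x ^ 2) Ω := by
    refine (integrable_const ((h ^ N * unitBallVolume N)⁻¹ * ∫ y, f y ^ 2)).mono'
      ((aestronglyMeasurable_ballMean h hf.aesm).restrict.pow 2) (.of_forall fun x => ?_)
    rw [Real.norm_of_nonneg (sq_nonneg _)]
    exact sq_ballMean_le hf.memLp x hh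
  have hD := hf.integrable_energyDensity
  set c := (unitBallVolume N)⁻¹ * h ^ (2 * s) with hc
  have hc0 : 0 ≤ c := by positivity
  calc ∫ x, f x ^ 2 = ∫ x in Ω, f x ^ 2 := h1
    _ ≤ ∫ x in Ω, (2 * (c * energyDensity s f x) + 2 * ballMean h f x ^ 2) := by
        refine integral_mono_ae hf.memLp.integrable_sq.integrableOn
          (((hD.const_mul c).const_mul 2).integrableOn.add (hbi.const_mul 2))
          (ae_restrict_of_ae ?_)
        filter_upwards [hf.finite_seminorm.prod_right_ae] with x hx
        have := sq_sub_ballMean_le hs0 hf.memLp hx hh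
        -- With $m$ the mean, $2(f-m)^2+2m^2-f^2=(f-2m)^2$.
        nlinarith [sq_nonneg (f x - 2 * ballMean h f x)]
    _ = 2 * (c * ∫ x in Ω, energyDensity s f x) + 2 * ∫ x in Ω, ballMean h f x ^ 2 := by
        rw [integral_add ((hD.const_mul c).const_mul 2).integrableOn (hbi.const_mul 2),
          integral_const_mul, integral_const_mul, integral_const_mul]
    _ ≤ _ := by
        rw [← hf.integral_energyDensity_eq hs0 hs1]
        gcongr
        · exact .of_forall fun x => energyDensity_nonneg x
        · exact Measure.restrict_le_self

/-- A sequence bounded in `X(Ω)` has a subsequence that is Cauchy in `L²`. -/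
lemma exists_subseq_cauchySeq (hs0 : 0 < s) (hs1 : s < 1)
    (hΩ_bdd : Bornology.IsBounded Ω) {u : ℕ → EuclideanSpace ℝ (Fin N) → ℝ} {M : ℝ}
    (hu : ∀ n, MemX s Ω (u n)) (hE : ∀ n, innerX s (u n) (u n) ≤ M)
    (hL : ∀ n, ∫ x, u n x ^ 2 ≤ M) : ∃ φ : ℕ → ℕ, StrictMono φ ∧
      CauchySeq fun n => (hu (φ n)).memLp.toLp (u (φ n)) := by
  have hω := unitBallVolume_pos (N := N)
  have hfc := fracConst_pos (N := N) hs0 hs1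
  have hM : 0 ≤ M := (innerX_self_nonneg hs0 hs1 _).trans (hE 0)
  have : Fact ((2 : ENNReal) ≠ ⊤) := ⟨by norm_num⟩
  obtain ⟨φ, hφ, L, hLim⟩ := exists_subseq_tendsto_inner
    (x := fun n => (hu n).memLp.toLp (u n)) (M := √M) (fun n => by
      refine Real.le_sqrt_of_sq_le ?_
      rw [norm_toLp_sq]; exact hL n)
  refine ⟨φ, hφ, ?_⟩
  have : IsFiniteMeasure (volume.restrict Ω) := ⟨by
    rw [Measure.restrict_apply_univ]; exact hΩ_bdd.measure_lt_top⟩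
  -- A ball mean is a multiple of the inner product with an indicator, so weak convergence makes the
  -- means converge at every point.
  have hmean : ∀ h : ℝ, ∃ A : EuclideanSpace ℝ (Fin N) → ℝ,
      ∀ x, Tendsto (fun n => ballMean h (u (φ n)) x) atTop (𝓝 (A x)) := by
    intro h
    choose A hA using fun x => (⟨_, Tendsto.const_mul (h ^ N * unitBallVolume N)⁻¹
      (hLim (indicatorConstLp 2 (measurableSet_ball (x := x) (ε := h))
        measure_ball_lt_top.ne (1 : ℝ)))⟩ : ∃ a, Tendsto _ atTop (𝓝 a))
    refine ⟨A, fun x => (hA x).congr fun n => ?_⟩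
    rw [ballMean, L2.inner_indicatorConstLp_one]
    congr 1
    exact integral_congr_ae (ae_restrict_of_ae (hu (φ n)).memLp.coeFn_toLp)
  -- At fixed $h$ the means are uniformly bounded and $\Omega$ has finite measure, so dominated
  -- convergence upgrades this to $L^2(\Omega)$.
  have hmeanL : ∀ h : ℝ, 0 < h → ∃ A : EuclideanSpace ℝ (Fin N) → ℝ,
      (∀ n, IntegrableOn (fun x => (ballMean h (u (φ n)) x - A x) ^ 2) Ω) ∧
      Tendsto (fun n => ∫ x in Ω, (ballMean h (u (φ n)) x - A x) ^ 2) atTop (𝓝 0) := by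
    intro h hh
    obtain ⟨A, hA⟩ := hmean h
    set c := (h ^ N * unitBallVolume N)⁻¹ * M
    have hb : ∀ n x, ballMean h (u (φ n)) x ^ 2 ≤ c := fun n x =>
      (sq_ballMean_le (hu _).memLp x hh).trans
        (mul_le_mul_of_nonneg_left (hL _) (by positivity))
    have hAb : ∀ x, A x ^ 2 ≤ c := fun x => le_of_tendsto' ((hA x).pow 2) fun n => hb n x
    have hbd : ∀ n x, ‖(ballMean h (u (φ n)) x - A x) ^ 2‖ ≤ 4 * c := fun n x => by
      rw [Real.norm_of_nonneg (sq_nonneg _)]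
      nlinarith [hb n x, hAb x, sq_nonneg (ballMean h (u (φ n)) x + A x)]
    have hbm : ∀ n, AEStronglyMeasurable (ballMean h (u (φ n))) (volume.restrict Ω) := fun n =>
      (aestronglyMeasurable_ballMean h (hu _).aesm).restrict
    have hAm : AEStronglyMeasurable A (volume.restrict Ω) :=
      aestronglyMeasurable_of_tendsto_ae atTop hbm (.of_forall hA)
    refine ⟨A, fun n => (integrable_const (4 * c)).mono' (((hbm n).sub hAm).pow 2)
      (.of_forall (hbd n)), ?_⟩
    have := tendsto_integral_of_dominated_convergence (μ := volume.restrict Ω) (fun _ => 4 * c)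
      (fun n => ((hbm n).sub hAm).pow 2) (integrable_const _) (fun n => .of_forall (hbd n))
      (.of_forall fun x => ((hA x).sub_const (A x)).pow 2)
    simpa using this
  rw [Metric.cauchySeq_iff]
  intro ε hε
  -- Differences have energy at most $4M$, so a small $h$ brings their oscillation part below
  -- $\varepsilon^2/2$. The thresholds $\varepsilon^2/16$ for the means account for the other
  -- $\varepsilon^2/2$.
  obtain ⟨h, hh, hhε⟩ : ∃ h : ℝ, 0 < h ∧
      2 * ((unitBallVolume N)⁻¹ * h ^ (2 * s) * (2 / fracConst N s * (4 * M))) < ε ^ 2 / 2 := by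
    have hlim : Tendsto (fun h : ℝ =>
        2 * ((unitBallVolume N)⁻¹ * h ^ (2 * s) * (2 / fracConst N s * (4 * M)))) (𝓝[>] 0)
        (𝓝 (2 * ((unitBallVolume N)⁻¹ * 0 ^ (2 * s) * (2 / fracConst N s * (4 * M))))) := by
      refine Tendsto.const_mul _ (Tendsto.mul_const _ (Tendsto.const_mul _ ?_))
      exact ((Real.continuous_rpow_const (by linarith)).tendsto 0).mono_left nhdsWithin_le_nhds
    rw [Real.zero_rpow (by linarith), mul_zero, zero_mul, mul_zero] at hlim
    have h1 := hlim.eventually_lt_const (show 0 < ε ^ 2 / 2 by positivity)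
    obtain ⟨h, h2, h3⟩ := (h1.and self_mem_nhdsWithin).exists
    exact ⟨h, h3, h2⟩
  obtain ⟨A, hAi, hAt⟩ := hmeanL h hh
  obtain ⟨n₀, hn₀⟩ := eventually_atTop.1 (hAt.eventually_lt_const
    (show 0 < ε ^ 2 / 16 by positivity))
  refine ⟨n₀, fun m hm n hn => ?_⟩
  have hw := (hu (φ m)).sub (hu (φ n))
  have hbound := hw.integral_sq_le hs0 hs1 hΩ_bdd hh
  have hmn : ∫ x in Ω, ballMean h (u (φ m) - u (φ n)) x ^ 2 ≤
      2 * (∫ x in Ω, (ballMean h (u (φ m)) x - A x) ^ 2) +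
        2 * ∫ x in Ω, (ballMean h (u (φ n)) x - A x) ^ 2 := by
    rw [← integral_const_mul, ← integral_const_mul,
      ← integral_add ((hAi m).const_mul 2) ((hAi n).const_mul 2)]
    refine integral_mono_of_nonneg (.of_forall fun x => sq_nonneg _)
      (((hAi m).const_mul 2).add ((hAi n).const_mul 2)) (.of_forall fun x => ?_)
    simp only [ballMean_sub (hu (φ m)).memLp (hu (φ n)).memLp]
    nlinarith [sq_nonneg ((ballMean h (u (φ m)) x - A x) + (ballMean h (u (φ n)) x - A x))]
  have hEw : innerX s (u (φ m) - u (φ n)) (u (φ m) - u (φ n)) ≤ 4 * M := by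
    linarith [innerX_sub_le hs0 hs1 (hu (φ m)) (hu (φ n)), hE (φ m), hE (φ n)]
  have hEw' : 2 * ((unitBallVolume N)⁻¹ * h ^ (2 * s) *
      (2 / fracConst N s * innerX s (u (φ m) - u (φ n)) (u (φ m) - u (φ n)))) ≤
      2 * ((unitBallVolume N)⁻¹ * h ^ (2 * s) * (2 / fracConst N s * (4 * M))) := by gcongr
  have hlt : ‖hw.memLp.toLp _‖ ^ 2 < ε ^ 2 := by
    rw [norm_toLp_sq]
    linarith [hn₀ m hm, hn₀ n hn]
  rw [dist_eq_norm, ← MemLp.toLp_sub]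
  exact lt_of_pow_lt_pow_left₀ 2 hε.le hlt

/-- Compactness of the embedding of `X(Ω)` into `L^r`, `2 ≤ r < 2N/(N-2s)`, together with lower
semicontinuity of the energy. -/
theorem exists_subseq_tendsto (hs0 : 0 < s) (hs1 : s < 1) (hN : 2 * s < (N : ℝ))
    (hΩ_bdd : Bornology.IsBounded Ω)
    {u : ℕ → EuclideanSpace ℝ (Fin N) → ℝ} {M : ℝ}
    (hu : ∀ n, MemX s Ω (u n)) (hE : ∀ n, innerX s (u n) (u n) ≤ M)
    (hL : ∀ n, ∫ x, u n x ^ 2 ≤ M) :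
    ∃ φ : ℕ → ℕ, StrictMono φ ∧ ∃ (v : EuclideanSpace ℝ (Fin N) → ℝ) (ℓ : ℝ), MemX s Ω v ∧
      Tendsto (fun n => innerX s (u (φ n)) (u (φ n))) atTop (𝓝 ℓ) ∧ innerX s v v ≤ ℓ ∧
      (∀ᵐ x, Tendsto (fun n => u (φ n) x) atTop (𝓝 (v x))) ∧
      ∀ r : ℝ, 2 ≤ r → r < critExp N s →
        Tendsto (fun n => ∫ x, |u (φ n) x - v x| ^ r) atTop (𝓝 0) := by
  have hfc := fracConst_pos (N := N) hs0 hs1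
  have hC := sobolevConst_pos (N := N) (s := s)
  obtain ⟨φ₁, hφ₁, hcau⟩ := exists_subseq_cauchySeq hs0 hs1 hΩ_bdd hu hE hL
  obtain ⟨V, hV⟩ := cauchySeq_tendsto_of_complete hcau
  obtain ⟨φ₂, hφ₂, hae⟩ := (tendstoInMeasure_of_tendsto_Lp hV).exists_seq_tendsto_ae
  -- A further extraction makes the energies converge, so that lower semicontinuity can be stated
  -- against a true limit $\ell$.
  obtain ⟨ℓ, -, φ₃, hφ₃, hℓ⟩ := (isCompact_Icc (a := (0 : ℝ)) (b := M)).tendsto_subseq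
    (x := fun n => innerX s (u (φ₁ (φ₂ n))) (u (φ₁ (φ₂ n))))
    fun n => ⟨innerX_self_nonneg hs0 hs1 _, hE _⟩
  set φ := fun n => φ₁ (φ₂ (φ₃ n))
  have hφ : StrictMono φ := hφ₁.comp (hφ₂.comp hφ₃)
  set v : EuclideanSpace ℝ (Fin N) → ℝ := ⇑V
  have hvL : MemLp v 2 volume := Lp.memLp V
  have hconv : ∀ᵐ x, Tendsto (fun n => u (φ n) x) atTop (𝓝 (v x)) := by
    filter_upwards [hae, ae_all_iff.2 fun n => (hu (φ n)).memLp.coeFn_toLp] with x hx h2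
    exact (hx.comp hφ₃.tendsto_atTop).congr fun n => h2 n
  have hconvK : ∀ᵐ z ∂(volume.prod volume : Measure (EuclideanSpace ℝ (Fin N) × _)),
      Tendsto (fun n => gagliardoKernel s (u (φ n)) (u (φ n)) z) atTop
        (𝓝 (gagliardoKernel s v v z)) := by
    filter_upwards [Measure.quasiMeasurePreserving_fst.ae hconv,
      Measure.quasiMeasurePreserving_snd.ae hconv] with z h1 h2
    exact ((h1.sub h2).mul (h1.sub h2)).div_const _
  have hFatou : ∀ B, ℓ < B → Integrable (gagliardoKernel s v v) (volume.prod volume) ∧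
      ∫ z, gagliardoKernel s v v z ∂(volume.prod volume) ≤ 2 / fracConst N s * B := by
    intro B hB
    refine integral_le_of_tendsto_of_eventually_le (fun n => (hu (φ n)).finite_seminorm)
      (fun n => gagliardoKernel_self_nonneg s _) hconvK ?_
    filter_upwards [hℓ.eventually_lt_const hB] with n hn
    have hn' : innerX s (u (φ n)) (u (φ n)) < B := hn
    rw [innerX] at hn'
    rw [div_mul_eq_mul_div, le_div_iff₀ hfc]
    linarith
  have hvX : MemX s Ω v := ⟨hvL, (hFatou (ℓ + 1) (by linarith)).1, by
    filter_upwards [hconv, ae_all_iff.2 fun n => (hu (φ n)).zero_outside] with x h1 h2 hx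
    exact tendsto_nhds_unique h1 (tendsto_const_nhds.congr fun n => (h2 n hx).symm)⟩
  have hvℓ : innerX s v v ≤ ℓ := by
    refine le_of_forall_gt_imp_ge_of_dense fun B hB => ?_
    have := (hFatou B hB).2
    rw [div_mul_eq_mul_div, le_div_iff₀ hfc] at this
    rw [innerX]; linarith
  have hℓM : ℓ ≤ M := le_of_tendsto' hℓ fun n => hE _
  have hdiff : ∀ n, MemX s Ω (u (φ n) - v) := fun n => (hu _).sub hvX
  have hdE : ∀ n, innerX s (u (φ n) - v) (u (φ n) - v) ≤ 4 * M := fun n => by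
    linarith [innerX_sub_le hs0 hs1 (hu (φ n)) hvX, hE (φ n)]
  have h2lim : Tendsto (fun n => ∫ x, (u (φ n) - v) x ^ 2) atTop (𝓝 0) := by
    have h1 : Tendsto (fun n => ‖(hu (φ n)).memLp.toLp (u (φ n)) - V‖ ^ 2) atTop (𝓝 0) := by
      have := ((tendsto_iff_norm_sub_tendsto_zero.1 hV).comp
        (hφ₂.comp hφ₃).tendsto_atTop).pow 2
      simpa using this
    refine h1.congr fun n => ?_
    rw [← norm_toLp_sq (hdiff n).memLp, MemLp.toLp_sub (hu (φ n)).memLp hvL]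
    congr 3
    exact (Lp.toLp_coeFn V _).symm
  refine ⟨φ, hφ, v, ℓ, hvX, hℓ, hvℓ, hconv, fun r h2r hr => ?_⟩
  have hM : 0 ≤ M := (innerX_self_nonneg hs0 hs1 _).trans (hE 0)
  set K := (sobolevConst N s * (2 / fracConst N s * (4 * M))) ^ (critExp N s / 2)
  have hq := critExp_gt_two hs0 hN
  have hK : 0 ≤ K := by positivity
  have hle : ∀ T : ℝ, 0 < T → ∀ n, ∫ x, |u (φ n) x - v x| ^ r ≤
      T ^ (r - 2) * (∫ x, (u (φ n) - v) x ^ 2) + T ^ (r - critExp N s) * K := fun T hT n => by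
    refine (((hdiff n).integral_rpow_le hs0 hs1 hN h2r hr.le).2 T hT).trans ?_
    have h3 := innerX_self_nonneg hs0 hs1 (u (φ n) - v)
    have h4 : (sobolevConst N s * (2 / fracConst N s * innerX s (u (φ n) - v) (u (φ n) - v))) ^
        (critExp N s / 2) ≤ K :=
      Real.rpow_le_rpow (by positivity) (by gcongr; exact hdE n) (by linarith)
    gcongr
  refine (Metric.tendsto_atTop.2 fun ε hε => ?_)
  -- $T$ is fixed first, using $r<2^*_s$; the remaining $L^2$ term then tends to zero in $n$.
  obtain ⟨T, hT, hTε⟩ : ∃ T : ℝ, 0 < T ∧ T ^ (r - critExp N s) * K < ε / 2 := by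
    have h1 : Tendsto (fun T : ℝ => T ^ (r - critExp N s) * K) atTop (𝓝 (0 * K)) := by
      have := tendsto_rpow_neg_atTop (show 0 < critExp N s - r by linarith)
      simp only [neg_sub] at this
      exact this.mul_const K
    rw [zero_mul] at h1
    obtain ⟨T, h2, h3⟩ := ((h1.eventually_lt_const (half_pos hε)).and
      (eventually_gt_atTop 0)).exists
    exact ⟨T, h3, h2⟩
  have h5 : Tendsto (fun n => T ^ (r - 2) * (∫ x, (u (φ n) - v) x ^ 2)) atTop (𝓝 0) := by
    simpa using h2lim.const_mul (T ^ (r - 2))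
  obtain ⟨n₀, hn₀⟩ := eventually_atTop.1 (h5.eventually_lt_const (half_pos hε))
  refine ⟨n₀, fun n hn => ?_⟩
  have h6 : 0 ≤ ∫ x, |u (φ n) x - v x| ^ r := integral_nonneg fun x => by positivity
  rw [Real.dist_eq, sub_zero, abs_of_nonneg h6]
  linarith [hle T hT n, hn₀ n hn]

/-! ### The first eigenvalue and the Poincaré inequality -/

/-- The choice $t=-a/(|b|+1)$ makes the expression negative unless $a=0$, whatever the sign of $b$.
This yields the Euler–Lagrange equation of a quadratic functional. -/
lemma eq_zero_of_forall_nonneg {a b : ℝ} (h : ∀ t : ℝ, 0 ≤ 2 * t * a + t ^ 2 * b) : a = 0 := by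
  by_contra ha
  have hc : 0 < |b| + 1 := by positivity
  have h1 := h (-(a / (|b| + 1)))
  have h2 : 2 * -(a / (|b| + 1)) * a + (-(a / (|b| + 1))) ^ 2 * b =
      a ^ 2 / (|b| + 1) * (b / (|b| + 1) - 2) := by field_simp; ring
  rw [h2] at h1
  have h3 : 0 < a ^ 2 / (|b| + 1) := by positivity
  have h4 : b / (|b| + 1) ≤ 1 := by
    rw [div_le_one hc]; linarith [le_abs_self b]
  nlinarith

lemma tendsto_integral_mul {α : Type*} [MeasurableSpace α] {μ : Measure α} {F G : ℕ → α → ℝ}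
    {f g : α → ℝ} (hF : ∀ n, MemLp (F n) 2 μ) (hG : ∀ n, MemLp (G n) 2 μ) (hf : MemLp f 2 μ)
    (hg : MemLp g 2 μ) (hFf : Tendsto (fun n => ∫ x, |F n x - f x| ^ (2 : ℝ) ∂μ) atTop (𝓝 0))
    (hGg : Tendsto (fun n => ∫ x, |G n x - g x| ^ (2 : ℝ) ∂μ) atTop (𝓝 0)) :
    Tendsto (fun n => ∫ x, F n x * G n x ∂μ) atTop (𝓝 (∫ x, f x * g x ∂μ)) := by
  have key : ∀ {H : ℕ → α → ℝ} {h : α → ℝ} (hH : ∀ n, MemLp (H n) 2 μ) (hh : MemLp h 2 μ),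
      Tendsto (fun n => ∫ x, |H n x - h x| ^ (2 : ℝ) ∂μ) atTop (𝓝 0) →
      Tendsto (fun n => (hH n).toLp (H n)) atTop (𝓝 (hh.toLp h)) := by
    intro H h hH hh hlim
    rw [tendsto_iff_norm_sub_tendsto_zero]
    have h1 := (Real.continuous_sqrt.tendsto 0).comp hlim
    rw [Real.sqrt_zero] at h1
    refine h1.congr fun n => ?_
    rw [← MemLp.toLp_sub, Function.comp_apply, Real.sqrt_eq_iff_mul_self_eq
      (integral_nonneg fun x => by positivity) (norm_nonneg _), ← sq, norm_toLp_sq]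
    simp
  have hinner : ∀ {H K : α → ℝ} (hH : MemLp H 2 μ) (hK : MemLp K 2 μ),
      inner ℝ (hH.toLp H) (hK.toLp K) = ∫ x, H x * K x ∂μ := by
    intro H K hH hK
    rw [L2.inner_def]
    refine integral_congr_ae ?_
    filter_upwards [hH.coeFn_toLp, hK.coeFn_toLp] with x h1 h2
    simp [h1, h2, mul_comm]
  have := (key hF hf hFf).inner (key hG hg hGg) (𝕜 := ℝ)
  simpa only [hinner] using this

lemma integral_mul_add_smul {u' v' : EuclideanSpace ℝ (Fin N) → ℝ} (hu : MemX s Ω u)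
    (hv : MemX s Ω v) (hu' : MemX s Ω u') (hv' : MemX s Ω v') (t : ℝ) :
    ∫ x, (u + t • v) x * (u' + t • v') x =
      (∫ x, u x * u' x) + t * ((∫ x, u x * v' x) + ∫ x, v x * u' x) + t ^ 2 * ∫ x, v x * v' x := by
  have h1 := hu.integrable_mul hu'
  have h2 := hu.integrable_mul hv'
  have h3 := hv.integrable_mul hu'
  have h4 := hv.integrable_mul hv'
  have h23 : Integrable fun x => t * (u x * v' x + v x * u' x) := (h2.add h3).const_mul t
  have : ∀ x, (u + t • v) x * (u' + t • v') x =
      u x * u' x + t * (u x * v' x + v x * u' x) + t ^ 2 * (v x * v' x) := fun x => by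
    simp only [Pi.add_apply, Pi.smul_apply, smul_eq_mul]; ring
  simp_rw [this]
  rw [integral_add (f := fun x => u x * u' x + t * (u x * v' x + v x * u' x))
    (h1.add h23) (h4.const_mul _), integral_add h1 h23, integral_const_mul, integral_const_mul,
    integral_add h2 h3]

lemma ae_eq_zero_of_integral_sq_eq_zero (hu : MemX s Ω u) (h : ∫ x, u x * u x = 0) :
    u =ᵐ[volume] 0 := by
  have := (integral_eq_zero_iff_of_nonneg (fun x => mul_self_nonneg (u x))
    (hu.integrable_mul hu)).1 h
  filter_upwards [this] with x hx
  simpa using hx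

lemma integral_mul_self_distCompl_pos (hN : 0 < N) (hs0 : 0 < s) (hs1 : s < 1)
    (hΩ_open : IsOpen Ω) (hΩ_nonempty : Ω.Nonempty) (hΩ_bdd : Bornology.IsBounded Ω) :
    0 < ∫ x, distCompl Ω x * distCompl Ω x := by
  have hη := memX_distCompl hN hs0 hs1 hΩ_open hΩ_bdd
  refine (integral_nonneg fun x => mul_self_nonneg _).lt_of_ne fun h => ?_
  have h1 := ae_eq_zero_of_integral_sq_eq_zero hη h.symm
  have h2 : volume Ω = 0 := by
    refine measure_mono_null (fun x hx => ?_) h1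
    exact (distCompl_pos hN hΩ_open hΩ_bdd hx).ne'
  exact (hΩ_open.measure_pos volume hΩ_nonempty).ne' h2

lemma IsDirichletEigenvalue.nonneg (hs0 : 0 < s) (hs1 : s < 1) {lam : ℝ}
    (h : IsDirichletEigenvalue s Ω lam) : 0 ≤ lam := by
  obtain ⟨e, he, hne, heq⟩ := h
  have h1 := heq e he
  rw [he.setIntegral_eq] at h1
  have h2 : 0 < ∫ x, e x * e x := (integral_nonneg fun x => mul_self_nonneg _).lt_of_ne
    fun h => hne (ae_eq_zero_of_integral_sq_eq_zero he h.symm)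
  have h3 := innerX_self_nonneg hs0 hs1 e
  rw [h1] at h3
  exact nonneg_of_mul_nonneg_left h3 h2

/-- The Poincaré inequality with the first eigenvalue. -/
theorem firstEigenvalue_mul_le (hs0 : 0 < s) (hs1 : s < 1) (hN : 2 * s < (N : ℝ))
    (hΩ_open : IsOpen Ω) (hΩ_nonempty : Ω.Nonempty) (hΩ_bdd : Bornology.IsBounded Ω)
    (hw : MemX s Ω w) : firstEigenvalue s Ω * (∫ x, w x * w x) ≤ innerX s w w := by
  have hN0 : 0 < N := by
    have : (0 : ℝ) < N := by linarith
    exact_mod_cast this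
  have hη := memX_distCompl hN0 hs0 hs1 hΩ_open hΩ_bdd
  have hηpos := integral_mul_self_distCompl_pos hN0 hs0 hs1 hΩ_open hΩ_nonempty hΩ_bdd
  have hE0 : ∀ f : EuclideanSpace ℝ (Fin N) → ℝ, 0 ≤ innerX s f f :=
    fun f => innerX_self_nonneg hs0 hs1 f
  have hL0 : ∀ f : EuclideanSpace ℝ (Fin N) → ℝ, 0 ≤ ∫ x, f x * f x :=
    fun f => integral_nonneg fun x => mul_self_nonneg _
  -- Maximising $\int f^2$ on the unit ball of the full norm amounts to minimising the Rayleigh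
  -- quotient: the supremum $S$ corresponds to the eigenvalue $1/S-1$.
  set A : Set ℝ := {m | ∃ f, MemX s Ω f ∧ innerX s f f + (∫ x, f x * f x) ≤ 1 ∧
    m = ∫ x, f x * f x}
  have hAb : BddAbove A := ⟨1, by rintro _ ⟨f, -, h, rfl⟩; linarith [hE0 f]⟩
  have hscale : ∀ f, MemX s Ω f →
      (∫ x, f x * f x) ≤ sSup A * (innerX s f f + ∫ x, f x * f x) := by
    intro f hf
    set E := innerX s f f + ∫ x, f x * f x with hE
    rcases (add_nonneg (hE0 f) (hL0 f)).eq_or_lt with h | h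
    · have : ∫ x, f x * f x = 0 := by linarith [hE0 f, hL0 f]
      rw [this, hE, ← h, mul_zero]
    · have hsq : ((√E)⁻¹) ^ 2 = E⁻¹ := by rw [inv_pow, Real.sq_sqrt h.le]
      have hint : ∫ x, ((√E)⁻¹ • f) x * ((√E)⁻¹ • f) x = E⁻¹ * ∫ x, f x * f x := by
        rw [← hsq, ← integral_const_mul]
        refine integral_congr_ae (.of_forall fun x => ?_)
        simp only [Pi.smul_apply, smul_eq_mul]; ring
      have := le_csSup hAb (a := E⁻¹ * ∫ x, f x * f x) ⟨(√E)⁻¹ • f, hf.smul _, by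
        rw [innerX_smul_smul, hint, hsq, ← mul_add, inv_mul_cancel₀ h.ne'], hint.symm⟩
      rwa [inv_mul_eq_div, div_le_iff₀ h] at this
  have hS : 0 < sSup A := by
    have := hscale _ hη
    by_contra hneg
    nlinarith [hE0 (distCompl Ω)]
  have hAne : A.Nonempty := ⟨0, 0, MemX.zero s Ω, by simp [innerX, gagliardoKernel], by simp⟩
  obtain ⟨a, -, ha, haA⟩ := exists_seq_tendsto_sSup hAne hAb
  choose f hf hf1 hfa using haA
  obtain ⟨k, hk, v, ℓ, hv, hℓ, hvℓ, -, hconv⟩ := exists_subseq_tendsto hs0 hs1 hN hΩ_bdd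
    (u := f) (M := 1) hf (fun n => by linarith [hf1 n, hL0 (f n)])
    (fun n => by simp only [sq]; linarith [hf1 n, hE0 (f n)])
  have h2 := hconv 2 le_rfl (critExp_gt_two hs0 hN)
  have hlim := tendsto_integral_mul (fun n => (hf (k n)).memLp) (fun n => (hf (k n)).memLp)
    hv.memLp hv.memLp h2 h2
  have hlimS : Tendsto (fun n => ∫ x, f (k n) x * f (k n) x) atTop (𝓝 (sSup A)) :=
    (ha.comp hk.tendsto_atTop).congr fun n => hfa (k n)
  have hvS : ∫ x, v x * v x = sSup A := tendsto_nhds_unique hlim hlimS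
  have hv1 : ℓ + sSup A ≤ 1 := le_of_tendsto' (hℓ.add hlimS) fun n => hf1 (k n)
  set S := sSup A
  -- Lower semicontinuity gives $\le 1$; the scaled inequality at $v$ gives $\ge 1$.
  have hEv : innerX s v v + S = 1 := by
    have := hscale v hv
    rw [hvS] at this
    nlinarith
  have hweak : ∀ φ, MemX s Ω φ → innerX s v φ = (1 / S - 1) * ∫ x, v x * φ x := by
    intro φ hφ
    -- The quadratic functional $S(\langle f,f\rangle_X+\int f^2)-\int f^2$ is nonnegative and
    -- vanishes at $v$, so its linear term there vanishes.
    have h0 := eq_zero_of_forall_nonneg (a := S * (innerX s v φ + ∫ x, v x * φ x) - ∫ x, v x * φ x)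
      (b := S * (innerX s φ φ + ∫ x, φ x * φ x) - ∫ x, φ x * φ x) (fun t => by
        have h1 := hscale _ (hv.add (hφ.smul t))
        rw [innerX_add_smul hv hφ, integral_mul_add_smul hv hφ hv hφ, hvS] at h1
        have h3 : ∫ x, φ x * v x = ∫ x, v x * φ x := by simp only [mul_comm]
        rw [h3] at h1
        nlinarith)
    field_simp
    linarith
  have heig : IsDirichletEigenvalue s Ω (1 / S - 1) := by
    refine ⟨v, hv, fun h => ?_, fun φ hφ => by rw [hφ.setIntegral_eq, hweak φ hφ]⟩
    have : ∫ x, v x * v x = 0 := by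
      rw [integral_congr_ae (g := 0)]
      · simp
      · filter_upwards [h] with x hx; simp [hx]
    linarith
  have hle : firstEigenvalue s Ω ≤ 1 / S - 1 :=
    csInf_le ⟨0, fun lam h => IsDirichletEigenvalue.nonneg hs0 hs1 h⟩ heig
  have h4 := hscale w hw
  have h5 : (1 / S - 1) * (∫ x, w x * w x) ≤ innerX s w w := by
    refine le_of_mul_le_mul_left ?_ hS
    have : S * ((1 / S - 1) * (∫ x, w x * w x)) = (∫ x, w x * w x) - S * ∫ x, w x * w x := by
      field_simp
    rw [this]; linarith
  exact (mul_le_mul_of_nonneg_right hle (hL0 w)).trans h5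

lemma firstEigenvalue_nonneg (hs0 : 0 < s) (hs1 : s < 1) : 0 ≤ firstEigenvalue s Ω :=
  Real.sInf_nonneg fun _ h => IsDirichletEigenvalue.nonneg hs0 hs1 h

/-! ### The quadratic form of the linear part and its coercivity -/

section QuadraticForm

variable {a b c : ℝ}

/-- The bilinear form of the linear part of the system. -/
def pairForm (s a b c : ℝ) (u v φ ψ : EuclideanSpace ℝ (Fin N) → ℝ) : ℝ :=
  innerX s u φ + innerX s v ψ - (a * (∫ x, u x * φ x) + b * ((∫ x, u x * ψ x) + ∫ x, v x * φ x) +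
    c * ∫ x, v x * ψ x)

lemma pairForm_add_smul (hu : MemX s Ω u) (hv : MemX s Ω v) (hφ : MemX s Ω φ) (hψ : MemX s Ω ψ)
    (t : ℝ) : pairForm s a b c (u + t • φ) (v + t • ψ) (u + t • φ) (v + t • ψ) =
      pairForm s a b c u v u v + 2 * t * pairForm s a b c u v φ ψ +
        t ^ 2 * pairForm s a b c φ ψ φ ψ := by
  simp only [pairForm]
  rw [innerX_add_smul hu hφ, innerX_add_smul hv hψ, integral_mul_add_smul hu hφ hu hφ,
    integral_mul_add_smul hu hφ hv hψ, integral_mul_add_smul hv hψ hu hφ,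
    integral_mul_add_smul hv hψ hv hψ]
  have h1 : ∫ x, φ x * u x = ∫ x, u x * φ x := by simp only [mul_comm]
  have h2 : ∫ x, ψ x * v x = ∫ x, v x * ψ x := by simp only [mul_comm]
  have h3 : ∫ x, φ x * v x = ∫ x, v x * φ x := by simp only [mul_comm]
  have h4 : ∫ x, ψ x * u x = ∫ x, u x * ψ x := by simp only [mul_comm]
  rw [h1, h2, h3, h4]
  ring

lemma pairForm_smul_smul (t : ℝ) :
    pairForm s a b c (t • u) (t • v) φ ψ = t * pairForm s a b c u v φ ψ := by
  simp only [pairForm, innerX_smul_left, Pi.smul_apply, smul_eq_mul, mul_assoc, integral_const_mul]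
  ring

lemma pairForm_smul_self (t : ℝ) :
    pairForm s a b c (t • u) (t • v) (t • u) (t • v) = t ^ 2 * pairForm s a b c u v u v := by
  rw [pairForm_smul_smul]
  simp only [pairForm, innerX_comm s _ (t • _), innerX_smul_left, Pi.smul_apply, smul_eq_mul,
    mul_left_comm _ t, integral_const_mul]
  ring

/-- Taking absolute values lowers the energies, keeps the squares and raises $\int uv$; the last is
favourable because $b\ge0$. -/
lemma pairForm_abs_le (hs0 : 0 < s) (hs1 : s < 1) (hb : 0 ≤ b) (hu : MemX s Ω u)
    (hv : MemX s Ω v) :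
    pairForm s a b c (fun x => |u x|) (fun x => |v x|) (fun x => |u x|) (fun x => |v x|) ≤
      pairForm s a b c u v u v := by
  simp only [pairForm, abs_mul_abs_self]
  have h1 := innerX_abs_le hs0 hs1 hu
  have h2 := innerX_abs_le hs0 hs1 hv
  have h3 : ∫ x, u x * v x ≤ ∫ x, |u x| * |v x| :=
    integral_mono (hu.integrable_mul hv) (hu.abs.integrable_mul hv.abs) fun x => by
      simp only [← abs_mul]; exact le_abs_self _
  have h4 : ∫ x, v x * u x ≤ ∫ x, |v x| * |u x| := by
    simpa only [mul_comm] using h3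
  have := mul_le_mul_of_nonneg_left (add_le_add h3 h4) hb
  linarith

/-- The quadratic form of a symmetric `2 × 2` matrix is bounded by its largest eigenvalue. -/
lemma quadratic_le_of_charpoly_roots {μ₁ μ₂ : ℝ}
    (hμ : (!![a, b; b, c] : Matrix (Fin 2) (Fin 2) ℝ).charpoly.roots = {μ₁, μ₂})
    (hμ_le : μ₁ ≤ μ₂) (x y : ℝ) :
    a * x ^ 2 + 2 * b * (x * y) + c * y ^ 2 ≤ μ₂ * (x ^ 2 + y ^ 2) := by
  have hroot : ∀ t ∈ ({μ₁, μ₂} : Multiset ℝ), (a - t) * (c - t) = b ^ 2 := by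
    intro t ht
    rw [← hμ, Polynomial.mem_roots (Matrix.charpoly_monic _).ne_zero, Polynomial.IsRoot,
      Matrix.charpoly_fin_two] at ht
    simp [Matrix.trace_fin_two, Matrix.det_fin_two] at ht
    linarith
  have hsum : μ₁ + μ₂ = a + c := by
    have h1 := Matrix.charpoly_fin_two (!![a, b; b, c] : Matrix (Fin 2) (Fin 2) ℝ)
    have hsplit : (!![a, b; b, c] : Matrix (Fin 2) (Fin 2) ℝ).charpoly.Splits := by
      rw [Polynomial.splits_iff_card_roots, hμ, Matrix.charpoly_natDegree_eq_dim]; simp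
    have h2 := Matrix.trace_eq_sum_roots_charpoly_of_splits hsplit
    rw [hμ] at h2
    simp [Matrix.trace_fin_two] at h2
    linarith
  have h1 := hroot μ₁ (by simp)
  have h2 := hroot μ₂ (by simp)
  -- $A$ and $C$ are the diagonal entries of $\mu_2 I$ minus the matrix, which has determinant $0$
  -- and trace $\mu_2-\mu_1\ge0$, hence is positive semidefinite.
  set A := μ₂ - a
  set C := μ₂ - c
  have hAC : A * C = b ^ 2 := by simp only [A, C]; linarith
  have hApC : 0 ≤ A + C := by simp only [A, C]; linarith
  have hA : 0 ≤ A := by nlinarith [sq_nonneg b, sq_nonneg A]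
  have hC : 0 ≤ C := by nlinarith [sq_nonneg b, sq_nonneg C]
  have key : 0 ≤ A * x ^ 2 - 2 * b * (x * y) + C * y ^ 2 := by
    rcases hA.eq_or_lt with h | h
    · have : b = 0 := by rw [← h, zero_mul] at hAC; exact pow_eq_zero_iff two_ne_zero |>.1 hAC.symm
      rw [← h, this]; nlinarith [mul_nonneg hC (sq_nonneg y)]
    · refine nonneg_of_mul_nonneg_right ?_ h
      have : A * (A * x ^ 2 - 2 * b * (x * y) + C * y ^ 2) = (A * x - b * y) ^ 2 := by
        linear_combination y ^ 2 * hAC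
      rw [this]; positivity
  simp only [A, C] at key
  linarith

/-- A fraction $\varepsilon$ of the energy is kept and the rest is spent on Poincaré. What remains
of the $L^2$ part is $(1-\varepsilon)\lambda-\mu$, and it is at least $\varepsilon$ exactly when
$\varepsilon(\lambda+1)\le\lambda-\mu$. -/
lemma exists_coercive (hs0 : 0 < s) (hs1 : s < 1) (hN : 2 * s < (N : ℝ))
    (hΩ_open : IsOpen Ω) (hΩ_nonempty : Ω.Nonempty) (hΩ_bdd : Bornology.IsBounded Ω) {μ : ℝ}
    (hquad : ∀ x y : ℝ, a * x ^ 2 + 2 * b * (x * y) + c * y ^ 2 ≤ μ * (x ^ 2 + y ^ 2))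
    (hμ : μ < firstEigenvalue s Ω) :
    ∃ ε > 0, ∀ u v : EuclideanSpace ℝ (Fin N) → ℝ, MemX s Ω u → MemX s Ω v →
      ε * (innerX s u u + innerX s v v + ((∫ x, u x * u x) + ∫ x, v x * v x)) ≤
        pairForm s a b c u v u v := by
  have hlam := firstEigenvalue_nonneg (Ω := Ω) hs0 hs1
  set lam := firstEigenvalue s Ω
  set ε := min (1 / 2) ((lam - μ) / (lam + 1)) with hε
  have hε0 : 0 < ε := lt_min (by norm_num) (div_pos (by linarith) (by linarith))
  have hε1 : ε ≤ 1 / 2 := min_le_left _ _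
  have hε2 : ε * (lam + 1) ≤ lam - μ := by
    rw [← le_div_iff₀ (by linarith)]; exact min_le_right _ _
  refine ⟨ε, hε0, fun u v hu hv => ?_⟩
  have h1 := firstEigenvalue_mul_le hs0 hs1 hN hΩ_open hΩ_nonempty hΩ_bdd hu
  have h2 := firstEigenvalue_mul_le hs0 hs1 hN hΩ_open hΩ_nonempty hΩ_bdd hv
  have hu0 : 0 ≤ ∫ x, u x * u x := integral_nonneg fun x => mul_self_nonneg _
  have hv0 : 0 ≤ ∫ x, v x * v x := integral_nonneg fun x => mul_self_nonneg _
  have iu := hu.integrable_mul hu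
  have iv := hv.integrable_mul hv
  have iuv := hu.integrable_mul hv
  have h3 : a * (∫ x, u x * u x) + 2 * b * (∫ x, u x * v x) + c * (∫ x, v x * v x) ≤
      μ * ((∫ x, u x * u x) + ∫ x, v x * v x) := by
    have iab : Integrable fun x => a * (u x * u x) + 2 * b * (u x * v x) :=
      (iu.const_mul a).add (iuv.const_mul _)
    rw [← integral_add iu iv, ← integral_const_mul, ← integral_const_mul, ← integral_const_mul,
      ← integral_const_mul, ← integral_add (iu.const_mul a) (iuv.const_mul _),
      ← integral_add iab (iv.const_mul c)]
    refine integral_mono (iab.add (iv.const_mul c))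
      ((iu.add iv).const_mul μ) fun x => ?_
    have := hquad (u x) (v x)
    simp only [sq] at this
    exact this
  have h4 : ∫ x, v x * u x = ∫ x, u x * v x := by simp only [mul_comm]
  rw [pairForm, h4]
  set Lu := ∫ x, u x * u x
  set Lv := ∫ x, v x * v x
  have h5 : (1 - ε) * (lam * (Lu + Lv)) ≤ (1 - ε) * (innerX s u u + innerX s v v) :=
    mul_le_mul_of_nonneg_left (by linarith) (by linarith)
  have h6 := mul_le_mul_of_nonneg_right hε2 (add_nonneg hu0 hv0)
  linarith

end QuadraticForm

/-! ### Elementary inequalities for powers -/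

section PowerInequalities

lemma add_rpow_le_two_rpow_mul {x y r : ℝ} (hx : 0 ≤ x) (hy : 0 ≤ y) (hr : 0 ≤ r) :
    (x + y) ^ r ≤ 2 ^ r * (x ^ r + y ^ r) := by
  have h1 : 0 ≤ x ^ r := by positivity
  have h2 : 0 ≤ y ^ r := by positivity
  rcases le_total x y with h | h
  · calc (x + y) ^ r ≤ (2 * y) ^ r := Real.rpow_le_rpow (by linarith) (by linarith) hr
      _ = 2 ^ r * y ^ r := Real.mul_rpow two_pos.le hy
      _ ≤ _ := mul_le_mul_of_nonneg_left (by linarith) (by positivity)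
  · calc (x + y) ^ r ≤ (2 * x) ^ r := Real.rpow_le_rpow (by linarith) (by linarith) hr
      _ = 2 ^ r * x ^ r := Real.mul_rpow two_pos.le hx
      _ ≤ _ := mul_le_mul_of_nonneg_left (by linarith) (by positivity)

lemma rpow_mul_rpow_le_add {x y : ℝ} (hx : 0 ≤ x) (hy : 0 ≤ y) (hp : 0 ≤ p) (hq : 0 ≤ q) :
    x ^ p * y ^ q ≤ x ^ (p + q) + y ^ (p + q) := by
  have h1 : 0 ≤ x ^ (p + q) := by positivity
  have h2 : 0 ≤ y ^ (p + q) := by positivity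
  rcases le_total x y with h | h
  · calc x ^ p * y ^ q ≤ y ^ p * y ^ q :=
        mul_le_mul_of_nonneg_right (Real.rpow_le_rpow hx h hp) (by positivity)
      _ = y ^ (p + q) := (Real.rpow_add_of_nonneg hy hp hq).symm
      _ ≤ _ := by linarith
  · calc x ^ p * y ^ q ≤ x ^ p * x ^ q :=
        mul_le_mul_of_nonneg_left (Real.rpow_le_rpow hy h hq) (by positivity)
      _ = x ^ (p + q) := (Real.rpow_add_of_nonneg hx hp hq).symm
      _ ≤ _ := by linarith

/-- The left side is the derivative of $|x|^p$. The exponent $p-2$ may be negative or zero, so $x=0$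
is treated apart. -/
lemma abs_deriv_abs_rpow (hp : 1 < p) (x : ℝ) : |p * |x| ^ (p - 2) * x| = p * |x| ^ (p - 1) := by
  rw [abs_mul, abs_mul, abs_of_pos (by linarith : 0 < p), abs_of_nonneg (by positivity),
    mul_assoc]
  rcases (abs_nonneg x).eq_or_lt with h | h
  · rw [← h, mul_zero, Real.zero_rpow (by linarith)]
  · congr 1
    nth_rewrite 2 [← Real.rpow_one |x|]
    rw [← Real.rpow_add h]; congr 1; ring

lemma deriv_abs_rpow_of_nonneg (hp : 1 < p) {x : ℝ} (hx : 0 ≤ x) :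
    p * |x| ^ (p - 2) * x = p * x ^ (p - 1) := by
  have hp0 : 0 < p := by linarith
  rw [← abs_of_nonneg (by positivity : 0 ≤ p * |x| ^ (p - 2) * x), abs_deriv_abs_rpow hp,
    abs_of_nonneg hx]

/-- The exponents $p-1$, $1$, $q$ add up to $p+q$; this supplies the dominating function for
differentiating the coupling. -/
lemma abs_deriv_mul_le (hp : 1 < p) (hq : 0 ≤ q) {x y z m : ℝ} (hx : |x| ≤ m) (hy : |y| ≤ m)
    (hz : |z| ≤ m) : |p * |x| ^ (p - 2) * x * z * |y| ^ q| ≤ p * m ^ (p + q) := by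
  have hm : 0 ≤ m := (abs_nonneg x).trans hx
  rw [abs_mul, abs_mul, abs_deriv_abs_rpow hp, abs_of_nonneg (by positivity : 0 ≤ |y| ^ q)]
  calc p * |x| ^ (p - 1) * |z| * |y| ^ q ≤ p * m ^ (p - 1) * m * m ^ q := by
        have h1 : |x| ^ (p - 1) ≤ m ^ (p - 1) := Real.rpow_le_rpow (abs_nonneg _) hx (by linarith)
        have h2 : |y| ^ q ≤ m ^ q := Real.rpow_le_rpow (abs_nonneg _) hy hq
        have : 0 < p := by linarith
        gcongr
    _ = p * (m ^ (p - 1) * m ^ (1 : ℝ) * m ^ q) := by rw [Real.rpow_one]; ring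
    _ = p * m ^ (p + q) := by
        rw [← Real.rpow_add_of_nonneg hm (by linarith) zero_le_one,
          ← Real.rpow_add_of_nonneg hm (by linarith) hq]
        congr 2; ring

end PowerInequalities

/-! ### The coupling functional: differentiability and semicontinuity -/

/-- The coupling functional `∫ |u|^p |v|^q`. -/
def coupling (p q : ℝ) (u v : EuclideanSpace ℝ (Fin N) → ℝ) : ℝ := ∫ x, |u x| ^ p * |v x| ^ q

lemma coupling_nonneg : 0 ≤ coupling p q u v := integral_nonneg fun x => by positivity

lemma aestronglyMeasurable_abs_rpow_mul (hu : AEStronglyMeasurable u volume)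
    (hv : AEStronglyMeasurable v volume) :
    AEStronglyMeasurable (fun x => |u x| ^ p * |v x| ^ q) volume :=
  ((hu.norm.aemeasurable.pow_const p).mul (hv.norm.aemeasurable.pow_const q)).aestronglyMeasurable

lemma integrable_abs_rpow_mul (hp : 0 ≤ p) (hq : 0 ≤ q) (hu : AEStronglyMeasurable u volume)
    (hv : AEStronglyMeasurable v volume) (hu' : Integrable fun x => |u x| ^ (p + q))
    (hv' : Integrable fun x => |v x| ^ (p + q)) :
    Integrable fun x => |u x| ^ p * |v x| ^ q :=
  (hu'.add hv').mono' (aestronglyMeasurable_abs_rpow_mul hu hv) (.of_forall fun x => by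
    rw [Real.norm_of_nonneg (by positivity)]
    exact rpow_mul_rpow_le_add (abs_nonneg _) (abs_nonneg _) hp hq)

lemma coupling_smul (hp : 0 ≤ p) (hq : 0 ≤ q) {t : ℝ} (ht : 0 ≤ t) :
    coupling p q (t • u) (t • v) = t ^ (p + q) * coupling p q u v := by
  rw [coupling, coupling, ← integral_const_mul]
  congr 1; funext x
  simp only [Pi.smul_apply, smul_eq_mul, abs_mul, abs_of_nonneg ht]
  rw [Real.mul_rpow ht (abs_nonneg _), Real.mul_rpow ht (abs_nonneg _),
    Real.rpow_add_of_nonneg ht hp hq]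
  ring

lemma memLp_ofReal_iff {r : ℝ} (hr : 0 < r) (hu : AEStronglyMeasurable u volume) :
    MemLp u (ENNReal.ofReal r) volume ↔ Integrable fun x => |u x| ^ r := by
  rw [← integrable_norm_rpow_iff hu (by simpa using hr) ENNReal.ofReal_ne_top,
    ENNReal.toReal_ofReal hr.le]
  rfl

/-- Directional derivative of the coupling functional at a nonnegative pair. -/
lemma hasDerivAt_coupling (hp : 1 < p) (hq : 1 < q)
    (hu : MemLp u (ENNReal.ofReal (p + q)) volume) (hv : MemLp v (ENNReal.ofReal (p + q)) volume)
    (hφ : MemLp φ (ENNReal.ofReal (p + q)) volume) (hψ : MemLp ψ (ENNReal.ofReal (p + q)) volume)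
    (hu0 : ∀ x, 0 ≤ u x) (hv0 : ∀ x, 0 ≤ v x) :
    Integrable (fun x => p * (u x ^ (p - 1) * v x ^ q * φ x) +
      q * (u x ^ p * v x ^ (q - 1) * ψ x)) ∧
    HasDerivAt (fun t : ℝ => coupling p q (u + t • φ) (v + t • ψ))
      (∫ x, (p * (u x ^ (p - 1) * v x ^ q * φ x) + q * (u x ^ p * v x ^ (q - 1) * ψ x))) 0 := by
  have hr : 0 < p + q := by linarith
  -- Along the line $u+t\varphi$ may change sign, so the derivative is written for $|\cdot|^p$; it
  -- reduces to plain powers only at $t=0$.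
  set F' : ℝ → EuclideanSpace ℝ (Fin N) → ℝ := fun t x =>
    p * |u x + t * φ x| ^ (p - 2) * (u x + t * φ x) * φ x * |v x + t * ψ x| ^ q +
      |u x + t * φ x| ^ p * (q * |v x + t * ψ x| ^ (q - 2) * (v x + t * ψ x) * ψ x) with hF'
  have hF'0 : F' 0 = fun x => p * (u x ^ (p - 1) * v x ^ q * φ x) +
      q * (u x ^ p * v x ^ (q - 1) * ψ x) := by
    funext x
    simp only [hF', zero_mul, add_zero]
    rw [deriv_abs_rpow_of_nonneg hp (hu0 x), deriv_abs_rpow_of_nonneg hq (hv0 x),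
      abs_of_nonneg (hu0 x), abs_of_nonneg (hv0 x)]
    ring
  -- $m$ bounds $|u+t\varphi|$, $|v+t\psi|$, $|\varphi|$ and $|\psi|$ at once for $|t|\le1$.
  set m : EuclideanSpace ℝ (Fin N) → ℝ := fun x => ‖u x‖ + ‖v x‖ + (‖φ x‖ + ‖ψ x‖)
  have hmL : MemLp m (ENNReal.ofReal (p + q)) volume :=
    (hu.norm.add hv.norm).add (hφ.norm.add hψ.norm)
  have hm0 : ∀ x, 0 ≤ m x := fun x => by positivity
  have hmi : Integrable fun x => (p + q) * m x ^ (p + q) := by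
    have := (memLp_ofReal_iff hr hmL.1).1 hmL
    simp only [abs_of_nonneg (hm0 _)] at this
    exact this.const_mul _
  have hut : ∀ t : ℝ, MemLp (u + t • φ) (ENNReal.ofReal (p + q)) volume :=
    fun t => hu.add (hφ.const_smul t)
  have hvt : ∀ t : ℝ, MemLp (v + t • ψ) (ENNReal.ofReal (p + q)) volume :=
    fun t => hv.add (hψ.const_smul t)
  have hmeas : AEStronglyMeasurable (F' 0) volume := by
    rw [hF'0]
    have h1 := hu.1.aemeasurable
    have h2 := hv.1.aemeasurable
    have h3 := hφ.1.aemeasurable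
    have h4 := hψ.1.aemeasurable
    exact (((((h1.pow_const (p - 1)).mul (h2.pow_const q)).mul h3).const_mul p).add
      ((((h1.pow_const p).mul (h2.pow_const (q - 1))).mul h4).const_mul q)).aestronglyMeasurable
  have := hasDerivAt_integral_of_dominated_loc_of_deriv_le (μ := volume)
    (F := fun (t : ℝ) x => |(u + t • φ) x| ^ p * |(v + t • ψ) x| ^ q) (F' := F') (x₀ := 0)
    (s := Metric.ball 0 1) (bound := fun x => (p + q) * m x ^ (p + q))
    (Metric.ball_mem_nhds 0 one_pos)
    (.of_forall fun t => aestronglyMeasurable_abs_rpow_mul (hut t).1 (hvt t).1)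
    (integrable_abs_rpow_mul (by linarith) (by linarith) (hut 0).1 (hvt 0).1
      ((memLp_ofReal_iff hr (hut 0).1).1 (hut 0)) ((memLp_ofReal_iff hr (hvt 0).1).1 (hvt 0)))
    hmeas (.of_forall fun x t ht => ?_) hmi (.of_forall fun x t _ => ?_)
  · rw [hF'0] at this
    exact this
  · have ht1 : |t| ≤ 1 := by
      rw [Metric.mem_ball, dist_zero_right, Real.norm_eq_abs] at ht
      exact ht.le
    have hle : ∀ y z : ℝ, |y + t * z| ≤ |y| + |z| := fun y z => by
      refine (abs_add_le _ _).trans ?_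
      rw [abs_mul]
      nlinarith [abs_nonneg z]
    have hux : |u x + t * φ x| ≤ m x := (hle _ _).trans (by
      simp only [m, Real.norm_eq_abs]; linarith [abs_nonneg (v x), abs_nonneg (ψ x)])
    have hvx : |v x + t * ψ x| ≤ m x := (hle _ _).trans (by
      simp only [m, Real.norm_eq_abs]; linarith [abs_nonneg (u x), abs_nonneg (φ x)])
    have hφx : |φ x| ≤ m x := by
      simp only [m, Real.norm_eq_abs]
      linarith [abs_nonneg (u x), abs_nonneg (v x), abs_nonneg (ψ x)]
    have hψx : |ψ x| ≤ m x := by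
      simp only [m, Real.norm_eq_abs]
      linarith [abs_nonneg (u x), abs_nonneg (v x), abs_nonneg (φ x)]
    have h1 := abs_deriv_mul_le hp (by linarith : 0 ≤ q) hux hvx hφx
    have h2 := abs_deriv_mul_le hq (by linarith : 0 ≤ p) hvx hux hψx
    rw [mul_comm _ (|u x + t * φ x| ^ p), add_comm q p] at h2
    rw [Real.norm_eq_abs, add_mul]
    exact (abs_add_le _ _).trans (add_le_add h1 h2)
  · have hd : ∀ y z : ℝ, HasDerivAt (fun t : ℝ => y + t * z) z t := fun y z => by
      simpa using ((hasDerivAt_id t).mul_const z).const_add y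
    exact ((hasDerivAt_abs_rpow _ hp).comp t (hd (u x) (φ x))).mul
      ((hasDerivAt_abs_rpow _ hq).comp t (hd (v x) (ψ x)))

lemma MemX.memLp_ofReal (hs0 : 0 < s) (hs1 : s < 1) (hN : 2 * s < (N : ℝ)) (hu : MemX s Ω u)
    {r : ℝ} (h2r : 2 ≤ r) (hr : r ≤ critExp N s) : MemLp u (ENNReal.ofReal r) volume :=
  (memLp_ofReal_iff (by linarith) hu.aesm).2 (hu.integral_rpow_le hs0 hs1 hN h2r hr).1

/-- Upper semicontinuity of the coupling functional under strong `L^(p+q)` convergence. -/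
lemma le_coupling_of_tendsto {F G : ℕ → EuclideanSpace ℝ (Fin N) → ℝ} {S : ℝ} (hp : 1 < p)
    (hq : 1 < q)
    (hF : ∀ n, MemLp (F n) (ENNReal.ofReal (p + q)) volume)
    (hG : ∀ n, MemLp (G n) (ENNReal.ofReal (p + q)) volume)
    (hf : MemLp f (ENNReal.ofReal (p + q)) volume) (hg : MemLp g (ENNReal.ofReal (p + q)) volume)
    (hFf : ∀ᵐ x, Tendsto (fun n => F n x) atTop (𝓝 (f x)))
    (hGg : ∀ᵐ x, Tendsto (fun n => G n x) atTop (𝓝 (g x)))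
    (hFi : Tendsto (fun n => ∫ x, |F n x - f x| ^ (p + q)) atTop (𝓝 0))
    (hGi : Tendsto (fun n => ∫ x, |G n x - g x| ^ (p + q)) atTop (𝓝 0))
    (hS : Tendsto (fun n => coupling p q (F n) (G n)) atTop (𝓝 S)) : S ≤ coupling p q f g := by
  have hr : 0 < p + q := by linarith
  have hp0 : 0 ≤ p := by linarith
  have hq0 : 0 ≤ q := by linarith
  have hpow : ∀ {h : EuclideanSpace ℝ (Fin N) → ℝ}, MemLp h (ENNReal.ofReal (p + q)) volume →
      Integrable fun x => |h x| ^ (p + q) := fun h => (memLp_ofReal_iff hr h.1).1 h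
  have iF := fun n => hpow ((hF n).sub hf)
  have iG := fun n => hpow ((hG n).sub hg)
  simp only [Pi.sub_apply] at iF iG
  have iFG := fun n => integrable_abs_rpow_mul hp0 hq0 (hF n).1 (hG n).1 (hpow (hF n)) (hpow (hG n))
  have ifg := integrable_abs_rpow_mul hp0 hq0 hf.1 hg.1 (hpow hf) (hpow hg)
  set K : ℝ := 2 ^ (p + q)
  have iH : ∀ n, Integrable fun x => K * (|F n x - f x| ^ (p + q) + |G n x - g x| ^ (p + q)) :=
    fun n => ((iF n).add (iG n)).const_mul K
  have ih : Integrable fun x => K * (|f x| ^ (p + q) + |g x| ^ (p + q)) :=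
    ((hpow hf).add (hpow hg)).const_mul K
  have iHh : ∀ n, Integrable fun x => K * (|F n x - f x| ^ (p + q) + |G n x - g x| ^ (p + q)) +
      K * (|f x| ^ (p + q) + |g x| ^ (p + q)) := fun n => (iH n).add ih
  -- $H_n$ is a convergent majorant minus the coupling integrand. Fatou applied to $H_n\ge0$ is the
  -- reverse Fatou inequality for the coupling.
  set H : ℕ → EuclideanSpace ℝ (Fin N) → ℝ := fun n x =>
    K * (|F n x - f x| ^ (p + q) + |G n x - g x| ^ (p + q)) +
      K * (|f x| ^ (p + q) + |g x| ^ (p + q)) - |F n x| ^ p * |G n x| ^ q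
  have hH0 : ∀ n x, 0 ≤ H n x := fun n x => by
    have h1 := rpow_mul_rpow_le_add (abs_nonneg (F n x)) (abs_nonneg (G n x)) hp0 hq0
    have h2 : ∀ y z : ℝ, |y| ^ (p + q) ≤ K * (|y - z| ^ (p + q) + |z| ^ (p + q)) := fun y z => by
      refine le_trans (Real.rpow_le_rpow (abs_nonneg _) ?_ hr.le)
        (add_rpow_le_two_rpow_mul (abs_nonneg (y - z)) (abs_nonneg z) hr.le)
      simpa using abs_add_le (y - z) z
    have h3 := h2 (F n x) (f x)
    have h4 := h2 (G n x) (g x)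
    simp only [H]
    linarith
  have hHint : ∀ n, ∫ x, H n x = K * ((∫ x, |F n x - f x| ^ (p + q)) +
      ∫ x, |G n x - g x| ^ (p + q)) + (∫ x, K * (|f x| ^ (p + q) + |g x| ^ (p + q))) -
      coupling p q (F n) (G n) := fun n => by
    simp only [H]
    rw [integral_sub (iHh n) (iFG n), integral_add (iH n) ih, integral_const_mul,
      integral_add (iF n) (iG n), coupling]
  set I := ∫ x, K * (|f x| ^ (p + q) + |g x| ^ (p + q))
  have hlim : Tendsto (fun n => ∫ x, H n x) atTop (𝓝 (I - S)) := by
    simp only [hHint]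
    simpa using (((hFi.add hGi).const_mul K).add_const I).sub hS
  have habs : ∀ {y : ℕ → ℝ} {z r : ℝ}, 0 < r → Tendsto y atTop (𝓝 z) →
      Tendsto (fun n => |y n| ^ r) atTop (𝓝 (|z| ^ r)) := fun hr h =>
    ((Real.continuous_rpow_const hr.le).tendsto _).comp h.abs
  have hae : ∀ᵐ x, Tendsto (fun n => H n x) atTop
      (𝓝 (K * (|f x| ^ (p + q) + |g x| ^ (p + q)) - |f x| ^ p * |g x| ^ q)) := by
    filter_upwards [hFf, hGg] with x h1 h2
    have h3 := (((habs hr (h1.sub_const (f x))).add (habs hr (h2.sub_const (g x)))).const_mul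
      K).add_const (K * (|f x| ^ (p + q) + |g x| ^ (p + q)))
    have h4 := (habs (by linarith : 0 < p) h1).mul (habs (by linarith : 0 < q) h2)
    have h5 := h3.sub h4
    simpa [Real.zero_rpow hr.ne'] using h5
  refine le_of_forall_pos_le_add fun ε hε => ?_
  have h6 := (integral_le_of_tendsto_of_eventually_le
    (fun n => (iHh n).sub (iFG n)) hH0 hae
    ((hlim.eventually_lt_const (show I - S < I - S + ε by linarith)).mono fun n => le_of_lt)).2
  rw [integral_sub ih ifg] at h6
  rw [coupling]
  linarith

/-! ### Constrained maximisation and the Euler–Lagrange system -/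

section Maximizer

variable {a b c : ℝ}

/-- Existence of a nonnegative maximiser of the coupling under the constraint given by the
quadratic form. -/
theorem exists_maximizer (hs0 : 0 < s) (hs1 : s < 1) (hN : 2 * s < (N : ℝ))
    (hΩ_open : IsOpen Ω) (hΩ_nonempty : Ω.Nonempty) (hΩ_bdd : Bornology.IsBounded Ω)
    (hp : 1 < p) (hq : 1 < q) (hpq : p + q < critExp N s) (hb : 0 ≤ b) {ε : ℝ} (hε : 0 < ε)
    (hcoer : ∀ u v : EuclideanSpace ℝ (Fin N) → ℝ, MemX s Ω u → MemX s Ω v →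
      ε * (innerX s u u + innerX s v v + ((∫ x, u x * u x) + ∫ x, v x * v x)) ≤
        pairForm s a b c u v u v) :
    ∃ (u v : EuclideanSpace ℝ (Fin N) → ℝ) (S : ℝ), MemX s Ω u ∧ MemX s Ω v ∧
      (∀ x, 0 ≤ u x) ∧ (∀ x, 0 ≤ v x) ∧ 0 < S ∧ pairForm s a b c u v u v = 1 ∧
      coupling p q u v = S ∧ ∀ f g, MemX s Ω f → MemX s Ω g →
        coupling p q f g ≤ S * (pairForm s a b c f g f g) ^ ((p + q) / 2) := by
  have hN0 : 0 < N := by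
    have : (0 : ℝ) < N := by linarith
    exact_mod_cast this
  have hr2 : 2 ≤ p + q := by linarith
  have hp0 : 0 ≤ p := by linarith
  have hq0 : 0 ≤ q := by linarith
  have hη := memX_distCompl hN0 hs0 hs1 hΩ_open hΩ_bdd
  have hE0 : ∀ f : EuclideanSpace ℝ (Fin N) → ℝ, 0 ≤ innerX s f f :=
    fun f => innerX_self_nonneg hs0 hs1 f
  have hL0 : ∀ f : EuclideanSpace ℝ (Fin N) → ℝ, 0 ≤ ∫ x, f x * f x :=
    fun f => integral_nonneg fun x => mul_self_nonneg _
  have hJ0 : ∀ f g, MemX s Ω f → MemX s Ω g → 0 ≤ pairForm s a b c f g f g := fun f g hf hg =>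
    (mul_nonneg hε.le (by linarith [hE0 f, hE0 g, hL0 f, hL0 g])).trans (hcoer f g hf hg)
  have hJbd : ∀ f g, MemX s Ω f → MemX s Ω g → pairForm s a b c f g f g ≤ 1 →
      innerX s f f + innerX s g g + ((∫ x, f x * f x) + ∫ x, g x * g x) ≤ 1 / ε :=
    fun f g hf hg h => by
      rw [le_div_iff₀ hε]; linarith [hcoer f g hf hg]
  have hpow : ∀ {f}, MemX s Ω f → MemLp f (ENNReal.ofReal (p + q)) volume := fun hf =>
    hf.memLp_ofReal hs0 hs1 hN hr2 hpq.le
  -- The constraint is $J\le1$ because only an inequality survives the limit; homogeneity restores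
  -- $J=1$ at the end.
  set A : Set ℝ := {m | ∃ f g, MemX s Ω f ∧ MemX s Ω g ∧ pairForm s a b c f g f g ≤ 1 ∧
    m = coupling p q f g} with hA
  have hAb : BddAbove A := by
    have hfc := fracConst_pos (N := N) hs0 hs1
    have hC := sobolevConst_pos (N := N) (s := s)
    have hcr := critExp_gt_two hs0 hN
    set B := 1 / ε + (sobolevConst N s * (2 / fracConst N s * (1 / ε))) ^ (critExp N s / 2)
    have hB : ∀ f, MemX s Ω f → innerX s f f ≤ 1 / ε → ∫ x, f x * f x ≤ 1 / ε →
        ∫ x, |f x| ^ (p + q) ≤ B := fun f hf h1 h2 => by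
      have h3 := (hf.integral_rpow_le hs0 hs1 hN hr2 hpq.le).2 1 one_pos
      simp only [Real.one_rpow, one_mul, sq] at h3
      refine h3.trans (add_le_add h2 (Real.rpow_le_rpow ?_ ?_ (by linarith)))
      · have := hE0 f; positivity
      · gcongr
    refine ⟨B + B, ?_⟩
    rintro _ ⟨f, g, hf, hg, hJ, rfl⟩
    have h1 := hJbd f g hf hg hJ
    have if' := (hf.integral_rpow_le hs0 hs1 hN hr2 hpq.le).1
    have ig' := (hg.integral_rpow_le hs0 hs1 hN hr2 hpq.le).1
    calc coupling p q f g ≤ ∫ x, (|f x| ^ (p + q) + |g x| ^ (p + q)) :=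
          integral_mono (integrable_abs_rpow_mul hp0 hq0 hf.aesm hg.aesm if' ig') (if'.add ig')
            fun x => rpow_mul_rpow_le_add (abs_nonneg _) (abs_nonneg _) hp0 hq0
      _ = (∫ x, |f x| ^ (p + q)) + ∫ x, |g x| ^ (p + q) := integral_add if' ig'
      _ ≤ B + B := add_le_add
          (hB f hf (by linarith [hE0 f, hE0 g, hL0 f, hL0 g])
            (by linarith [hE0 f, hE0 g, hL0 f, hL0 g]))
          (hB g hg (by linarith [hE0 f, hE0 g, hL0 f, hL0 g])
            (by linarith [hE0 f, hE0 g, hL0 f, hL0 g]))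
  have hscale : ∀ f g, MemX s Ω f → MemX s Ω g →
      coupling p q f g ≤ sSup A * (pairForm s a b c f g f g) ^ ((p + q) / 2) := by
    intro f g hf hg
    rcases (hJ0 f g hf hg).eq_or_lt with h | h
    -- If $J=0$, coercivity forces $f=0$ a.e. and both sides vanish; otherwise the pair is
    -- normalised by $\sqrt J$.
    · have h1 := hcoer f g hf hg
      rw [← h] at h1
      have h2 : ∫ x, f x * f x = 0 := by
        have := nonpos_of_mul_nonpos_right h1 hε
        linarith [hE0 f, hE0 g, hL0 f, hL0 g]
      have h3 : coupling p q f g = 0 := by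
        rw [coupling, integral_congr_ae (g := 0)]
        · simp
        · filter_upwards [ae_eq_zero_of_integral_sq_eq_zero hf h2] with x hx
          simp [hx, Real.zero_rpow (by linarith : p ≠ 0)]
      rw [h3, ← h, Real.zero_rpow (by linarith), mul_zero]
    · set E := pairForm s a b c f g f g
      have h1 : coupling p q ((√E)⁻¹ • f) ((√E)⁻¹ • g) ≤ sSup A :=
        le_csSup hAb ⟨_, _, hf.smul _, hg.smul _, by
          rw [pairForm_smul_self, inv_pow, Real.sq_sqrt h.le, inv_mul_cancel₀ h.ne'], rfl⟩
      have h2 : ((√E)⁻¹) ^ (p + q) = (E ^ ((p + q) / 2))⁻¹ := by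
        rw [Real.inv_rpow (Real.sqrt_nonneg _), Real.sqrt_eq_rpow, ← Real.rpow_mul h.le]
        congr 2; ring
      rw [coupling_smul hp0 hq0 (by positivity), h2, inv_mul_eq_div,
        div_le_iff₀ (by positivity)] at h1
      exact h1
  have hS : 0 < sSup A := by
    have h1 := hscale _ _ hη hη
    have h2 : 0 < coupling p q (distCompl Ω) (distCompl Ω) := by
      refine coupling_nonneg.lt_of_ne fun h => ?_
      have hi := (hη.integral_rpow_le hs0 hs1 hN hr2 hpq.le).1
      have h3 := (integral_eq_zero_iff_of_nonneg (fun x => by positivity)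
        (integrable_abs_rpow_mul hp0 hq0 hη.aesm hη.aesm hi hi)).1 h.symm
      have h4 : volume Ω = 0 := by
        refine measure_mono_null (fun x hx => ?_) h3
        have := distCompl_pos hN0 hΩ_open hΩ_bdd hx
        have h5 : 0 < |distCompl Ω x| ^ p * |distCompl Ω x| ^ q := by positivity
        exact h5.ne'
      exact (hΩ_open.measure_pos volume hΩ_nonempty).ne' h4
    exact pos_of_mul_pos_left (h2.trans_le h1) (Real.rpow_nonneg (hJ0 _ _ hη hη) _)
  have hAne : A.Nonempty := ⟨_, 0, 0, MemX.zero s Ω, MemX.zero s Ω,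
    by simp [pairForm, innerX, gagliardoKernel], rfl⟩
  obtain ⟨m, -, hm, hmA⟩ := exists_seq_tendsto_sSup hAne hAb
  choose f g hf hg hfg1 hmfg using hmA
  have hbdd := fun n => hJbd _ _ (hf n) (hg n) (hfg1 n)
  obtain ⟨k₁, hk₁, u, ℓu, hu, hℓu, huℓ, huae, huconv⟩ := exists_subseq_tendsto hs0 hs1 hN hΩ_bdd
    (u := f) (M := 1 / ε) hf
    (fun n => by linarith [hbdd n, hE0 (f n), hE0 (g n), hL0 (f n), hL0 (g n)])
    (fun n => by simp only [sq]; linarith [hbdd n, hE0 (f n), hE0 (g n), hL0 (f n), hL0 (g n)])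
  obtain ⟨k₂, hk₂, v, ℓv, hv, hℓv, hvℓ, hvae, hvconv⟩ := exists_subseq_tendsto hs0 hs1 hN hΩ_bdd
    (u := fun n => g (k₁ n)) (M := 1 / ε) (fun n => hg _)
    (fun n => by
      linarith [hbdd (k₁ n), hE0 (f (k₁ n)), hE0 (g (k₁ n)), hL0 (f (k₁ n)), hL0 (g (k₁ n))])
    (fun n => by
      simp only [sq]
      linarith [hbdd (k₁ n), hE0 (f (k₁ n)), hE0 (g (k₁ n)), hL0 (f (k₁ n)), hL0 (g (k₁ n))])
  have hk₂t := hk₂.tendsto_atTop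
  set F := fun n => f (k₁ (k₂ n))
  set G := fun n => g (k₁ (k₂ n))
  have hF : ∀ n, MemX s Ω (F n) := fun n => hf _
  have hG : ∀ n, MemX s Ω (G n) := fun n => hg _
  have hcr := critExp_gt_two hs0 hN
  have hSle : sSup A ≤ coupling p q u v := by
    refine le_coupling_of_tendsto (F := F) (G := G) hp hq (fun n => hpow (hF n))
      (fun n => hpow (hG n)) (hpow hu) (hpow hv) ?_ hvae ((huconv _ hr2 hpq).comp hk₂t)
      (hvconv _ hr2 hpq)
      ((hm.comp (hk₁.comp hk₂).tendsto_atTop).congr fun n => hmfg (k₁ (k₂ n)))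
    filter_upwards [huae] with x hx
    exact hx.comp hk₂t
  -- The energies are lower semicontinuous while all quadratic $L^2$ terms converge, so the signs of
  -- $a,b,c$ play no role in this limit.
  have hJuv : pairForm s a b c u v u v ≤ 1 := by
    have hu2 := (huconv 2 le_rfl hcr).comp hk₂t
    have hv2 := hvconv 2 le_rfl hcr
    have t1 := tendsto_integral_mul (fun n => (hF n).memLp) (fun n => (hF n).memLp)
      hu.memLp hu.memLp hu2 hu2
    have t2 := tendsto_integral_mul (fun n => (hF n).memLp) (fun n => (hG n).memLp)
      hu.memLp hv.memLp hu2 hv2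
    have t3 := tendsto_integral_mul (fun n => (hG n).memLp) (fun n => (hF n).memLp)
      hv.memLp hu.memLp hv2 hu2
    have t4 := tendsto_integral_mul (fun n => (hG n).memLp) (fun n => (hG n).memLp)
      hv.memLp hv.memLp hv2 hv2
    have t5 := ((hℓu.comp hk₂t).add hℓv).sub
      (((t1.const_mul a).add ((t2.add t3).const_mul b)).add (t4.const_mul c))
    have h1 := le_of_tendsto' t5 fun n => hfg1 (k₁ (k₂ n))
    rw [pairForm]
    linarith
  have hJabs := pairForm_abs_le (a := a) (c := c) hs0 hs1 hb hu hv
  have hcabs : coupling p q (fun x => |u x|) (fun x => |v x|) = coupling p q u v := by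
    simp only [coupling, abs_abs]
  have hJ1 := hJabs.trans hJuv
  have hceq : coupling p q (fun x => |u x|) (fun x => |v x|) = sSup A :=
    le_antisymm (le_csSup hAb ⟨_, _, hu.abs, hv.abs, hJ1, rfl⟩) (hSle.trans_eq hcabs.symm)
  refine ⟨fun x => |u x|, fun x => |v x|, sSup A, hu.abs, hv.abs, fun x => abs_nonneg _,
    fun x => abs_nonneg _, hS, le_antisymm hJ1 ?_, hceq, hscale⟩
  have h1 := hscale _ _ hu.abs hv.abs
  rw [hceq] at h1
  have h2 := le_of_mul_le_mul_left ((mul_one _).trans_le h1) hS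
  -- If $J<1$, the scaled inequality at the maximiser would read $S\le S\,J^{(p+q)/2}<S$.
  by_contra! h3
  exact absurd h2 (not_le.2 (Real.rpow_lt_one (hJ0 _ _ hu.abs hv.abs) h3 (by linarith)))

/-- A nonnegative nontrivial weak solution of the system. -/
theorem exists_nonneg_solution (hs0 : 0 < s) (hs1 : s < 1) (hN : 2 * s < (N : ℝ))
    (hΩ_open : IsOpen Ω) (hΩ_nonempty : Ω.Nonempty) (hΩ_bdd : Bornology.IsBounded Ω)
    (hp : 1 < p) (hq : 1 < q) (hpq : p + q < critExp N s) (hb : 0 ≤ b) {ε : ℝ} (hε : 0 < ε)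
    (hcoer : ∀ u v : EuclideanSpace ℝ (Fin N) → ℝ, MemX s Ω u → MemX s Ω v →
      ε * (innerX s u u + innerX s v v + ((∫ x, u x * u x) + ∫ x, v x * v x)) ≤
        pairForm s a b c u v u v) :
    ∃ u v : EuclideanSpace ℝ (Fin N) → ℝ, MemX s Ω u ∧ MemX s Ω v ∧
      (∀ x, 0 ≤ u x) ∧ (∀ x, 0 ≤ v x) ∧ ¬ u =ᵐ[volume] 0 ∧ ¬ v =ᵐ[volume] 0 ∧
      ∀ φ ψ, MemX s Ω φ → MemX s Ω ψ →
        Integrable (fun x => u x ^ (p - 1) * v x ^ q * φ x) ∧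
        Integrable (fun x => u x ^ p * v x ^ (q - 1) * ψ x) ∧
        pairForm s a b c u v φ ψ =
          2 * p / (p + q) * (∫ x, u x ^ (p - 1) * v x ^ q * φ x) +
          2 * q / (p + q) * ∫ x, u x ^ p * v x ^ (q - 1) * ψ x := by
  obtain ⟨u, v, S, hu, hv, hu0, hv0, hS, hJ, hc, hmax⟩ := exists_maximizer hs0 hs1 hN hΩ_open
    hΩ_nonempty hΩ_bdd hp hq hpq hb hε hcoer
  have hr2 : 2 < p + q := by linarith
  have hp0 : 0 < p := by linarith
  have hq0 : 0 < q := by linarith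
  have hpow : ∀ {f}, MemX s Ω f → MemLp f (ENNReal.ofReal (p + q)) volume := fun hf =>
    hf.memLp_ofReal hs0 hs1 hN hr2.le hpq.le
  have hint : ∀ φ ψ, MemX s Ω φ → MemX s Ω ψ →
      Integrable (fun x => u x ^ (p - 1) * v x ^ q * φ x) ∧
      Integrable (fun x => u x ^ p * v x ^ (q - 1) * ψ x) := by
    intro φ ψ hφ hψ
    -- A zero second direction isolates one of the two terms, giving its integrability separately.
    have h1 := (hasDerivAt_coupling hp hq (hpow hu) (hpow hv) (hpow hφ) (hpow (MemX.zero s Ω))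
      hu0 hv0).1.const_mul p⁻¹
    have h2 := (hasDerivAt_coupling hp hq (hpow hu) (hpow hv) (hpow (MemX.zero s Ω)) (hpow hψ)
      hu0 hv0).1.const_mul q⁻¹
    simp only [Pi.zero_apply, mul_zero, add_zero, zero_add, inv_mul_cancel_left₀ hp0.ne',
      inv_mul_cancel_left₀ hq0.ne'] at h1 h2
    exact ⟨h1, h2⟩
  have hEL : ∀ φ ψ, MemX s Ω φ → MemX s Ω ψ → S * (p + q) * pairForm s a b c u v φ ψ =
      p * (∫ x, u x ^ (p - 1) * v x ^ q * φ x) + q * ∫ x, u x ^ p * v x ^ (q - 1) * ψ x := by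
    intro φ ψ hφ hψ
    have hd := (hasDerivAt_coupling hp hq (hpow hu) (hpow hv) (hpow hφ) (hpow hψ) hu0 hv0).2
    rw [integral_add ((hint φ ψ hφ hψ).1.const_mul p) ((hint φ ψ hφ hψ).2.const_mul q),
      integral_const_mul, integral_const_mul] at hd
    have hJd : HasDerivAt (fun t : ℝ =>
        pairForm s a b c (u + t • φ) (v + t • ψ) (u + t • φ) (v + t • ψ))
        (2 * pairForm s a b c u v φ ψ) 0 := by
      simp only [pairForm_add_smul hu hv hφ hψ]
      have h1 := ((((hasDerivAt_id (0 : ℝ)).const_mul 2).mul_const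
        (pairForm s a b c u v φ ψ)).const_add (pairForm s a b c u v u v)).add
        (((hasDerivAt_id (0 : ℝ)).pow 2).mul_const (pairForm s a b c φ ψ φ ψ))
      exact h1.congr_deriv (by simp)
    have hJr := (hJd.rpow_const (p := (p + q) / 2) (Or.inl (by simp [hJ]))).const_mul S
    have hdiff := hJr.sub hd
    -- $S J^{(p+q)/2}$ minus the coupling is nonnegative on the whole line and zero at $t=0$: an
    -- unconstrained minimum, whose constant $S(p+q)$ appears explicitly.
    have hmin : IsLocalMin (fun t : ℝ =>
        S * pairForm s a b c (u + t • φ) (v + t • ψ) (u + t • φ) (v + t • ψ) ^ ((p + q) / 2) -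
          coupling p q (u + t • φ) (v + t • ψ)) 0 := by
      refine .of_forall fun t => ?_
      have h1 := hmax _ _ (hu.add (hφ.smul t)) (hv.add (hψ.smul t))
      simp only [zero_smul, add_zero, hJ, hc, Real.one_rpow, mul_one, sub_self]
      linarith
    have h0 := hmin.hasDerivAt_eq_zero hdiff
    simp only [zero_smul, add_zero, hJ, Real.one_rpow, mul_one] at h0
    linarith
  have hnz : 0 < coupling p q u v := hc ▸ hS
  -- Under dilation by $\tau$ the linear side scales like $\tau$ and the nonlinearity like
  -- $\tau^{p+q-1}$; the prescribed coefficients require $\tau^{p+q-2}=1/(2S)$.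
  set τ : ℝ := (2 * S) ^ (-(1 / (p + q - 2))) with hτ
  have hτ0 : 0 < τ := by positivity
  have hτr : τ ^ (p + q - 1) = τ / (2 * S) := by
    have h1 : τ ^ (p + q - 2) = (2 * S)⁻¹ := by
      rw [hτ, ← Real.rpow_mul (by positivity), neg_mul, one_div_mul_cancel (by linarith),
        Real.rpow_neg_one]
    rw [show p + q - 1 = (p + q - 2) + 1 by ring, Real.rpow_add hτ0, h1, Real.rpow_one]
    field_simp
  have hne : ∀ f : EuclideanSpace ℝ (Fin N) → ℝ, τ • f =ᵐ[volume] 0 → f =ᵐ[volume] 0 :=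
    fun f h => by
      filter_upwards [h] with x hx
      simpa [hτ0.ne'] using hx
  have hsc1 : ∀ (φ : EuclideanSpace ℝ (Fin N) → ℝ) x, (τ • u) x ^ (p - 1) * (τ • v) x ^ q * φ x =
      τ ^ (p + q - 1) * (u x ^ (p - 1) * v x ^ q * φ x) := fun φ x => by
    simp only [Pi.smul_apply, smul_eq_mul]
    rw [Real.mul_rpow hτ0.le (hu0 x), Real.mul_rpow hτ0.le (hv0 x),
      show p + q - 1 = (p - 1) + q by ring, Real.rpow_add hτ0]
    ring
  have hsc2 : ∀ (φ : EuclideanSpace ℝ (Fin N) → ℝ) x, (τ • u) x ^ p * (τ • v) x ^ (q - 1) * φ x =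
      τ ^ (p + q - 1) * (u x ^ p * v x ^ (q - 1) * φ x) := fun φ x => by
    simp only [Pi.smul_apply, smul_eq_mul]
    rw [Real.mul_rpow hτ0.le (hu0 x), Real.mul_rpow hτ0.le (hv0 x),
      show p + q - 1 = p + (q - 1) by ring, Real.rpow_add hτ0]
    ring
  refine ⟨τ • u, τ • v, hu.smul τ, hv.smul τ, fun x => mul_nonneg hτ0.le (hu0 x),
    fun x => mul_nonneg hτ0.le (hv0 x), fun h => ?_, fun h => ?_, fun φ ψ hφ hψ => ?_⟩
  -- The coupling is positive and its integrand is a product, so neither component can vanish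
  -- identically.
  · refine hnz.ne' ?_
    rw [coupling, integral_congr_ae (g := 0)]
    · simp
    · filter_upwards [hne u h] with x hx
      simp [hx, Real.zero_rpow hp0.ne']
  · refine hnz.ne' ?_
    rw [coupling, integral_congr_ae (g := 0)]
    · simp
    · filter_upwards [hne v h] with x hx
      simp [hx, Real.zero_rpow hq0.ne']
  · simp only [hsc1, hsc2, integral_const_mul, pairForm_smul_smul, hτr]
    refine ⟨(hint φ ψ hφ hψ).1.const_mul _, (hint φ ψ hφ hψ).2.const_mul _, ?_⟩
    have h1 := hEL φ ψ hφ hψ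
    have h2 : pairForm s a b c u v φ ψ = (p * (∫ x, u x ^ (p - 1) * v x ^ q * φ x) +
        q * ∫ x, u x ^ p * v x ^ (q - 1) * ψ x) / (S * (p + q)) := by
      rw [eq_div_iff (by positivity)]; linarith
    rw [h2]
    field_simp

end Maximizer

/-! ### The strong maximum principle -/

/-- With $w=\eta-u/\delta$ one has $u=\delta(\eta-w)$. Monotonicity of the positive part gives
$d^2\le(w_1-w_2)d$, and $(\eta_1-\eta_2)d-d^2\le\frac14(\eta_1-\eta_2)^2$. -/
lemma sub_mul_posPart_sub_le {δ : ℝ} (hδ : 0 < δ) (η₁ η₂ u₁ u₂ : ℝ) :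
    (u₁ - u₂) * (max (η₁ - δ⁻¹ * u₁) 0 - max (η₂ - δ⁻¹ * u₂) 0) ≤ δ / 4 * (η₁ - η₂) ^ 2 := by
  obtain ⟨w₁, hw₁⟩ : ∃ w, w = η₁ - δ⁻¹ * u₁ := ⟨_, rfl⟩
  obtain ⟨w₂, hw₂⟩ : ∃ w, w = η₂ - δ⁻¹ * u₂ := ⟨_, rfl⟩
  have h1 : u₁ = δ * (η₁ - w₁) := by rw [hw₁]; field_simp; ring
  have h2 : u₂ = δ * (η₂ - w₂) := by rw [hw₂]; field_simp; ring
  rw [← hw₁, ← hw₂, h1, h2]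
  set d := max w₁ 0 - max w₂ 0 with hd
  have hdd : d ^ 2 ≤ (w₁ - w₂) * d := by
    rcases max_cases w₁ 0 with ⟨e1, _⟩ | ⟨e1, _⟩ <;>
      rcases max_cases w₂ 0 with ⟨e2, _⟩ | ⟨e2, _⟩ <;> rw [hd, e1, e2] <;> nlinarith
  have : (η₁ - η₂) * d - (w₁ - w₂) * d ≤ 1 / 4 * (η₁ - η₂) ^ 2 := by
    nlinarith [sq_nonneg ((η₁ - η₂) - 2 * d)]
  calc (δ * (η₁ - w₁) - δ * (η₂ - w₂)) * d = δ * ((η₁ - η₂) * d - (w₁ - w₂) * d) := by ring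
    _ ≤ δ * (1 / 4 * (η₁ - η₂) ^ 2) := mul_le_mul_of_nonneg_left this hδ.le
    _ = _ := by ring

/-- The strong maximum principle for nonnegative weak supersolutions of `(-Δ)^s u + M u = 0`. -/
theorem ae_pos_of_supersolution (hN : 0 < N) (hs0 : 0 < s) (hs1 : s < 1) (hΩ_open : IsOpen Ω)
    (hΩ_bdd : Bornology.IsBounded Ω) (hu : MemX s Ω u) (hu0 : ∀ x, 0 ≤ u x)
    (hne : ¬ u =ᵐ[volume] 0) {M : ℝ} (hM : 0 ≤ M)
    (hsup : ∀ φ, MemX s Ω φ → (∀ x, 0 ≤ φ x) → -M * (∫ x, u x * φ x) ≤ innerX s u φ) :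
    ∀ᵐ x ∂(volume : Measure (EuclideanSpace ℝ (Fin N))), x ∈ Ω → 0 < u x := by
  classical
  have hη := memX_distCompl hN hs0 hs1 hΩ_open hΩ_bdd
  set η := distCompl Ω
  have hη0 : ∀ x, 0 ≤ η x := distCompl_nonneg
  have hfc := fracConst_pos (N := N) hs0 hs1
  -- The test functions $(\eta-u/\delta)^+$ with $\delta=1/(n+1)$ lie in $X(\Omega)$ and decrease to
  -- $\eta$ restricted to the zero set of $u$, which need not itself lie in $X(\Omega)$.
  set φ : ℕ → EuclideanSpace ℝ (Fin N) → ℝ := fun n x =>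
    max (η x - (1 / ((n : ℝ) + 1))⁻¹ * u x) 0
  have hφ : ∀ n, MemX s Ω (φ n) := fun n => (hη.sub (hu.smul _)).posPart
  set η₀ : EuclideanSpace ℝ (Fin N) → ℝ := fun x => if u x = 0 then η x else 0
  have hφlim : ∀ x, Tendsto (fun n => φ n x) atTop (𝓝 (η₀ x)) := by
    intro x
    refine tendsto_const_nhds.congr' ?_
    by_cases hx : u x = 0
    · exact .of_forall fun n => by simp [φ, η₀, hx, hη0 x]
    · have hpos : 0 < u x := (hu0 x).lt_of_ne' hx
      obtain ⟨n, hn⟩ := exists_nat_ge (η x / u x)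
      filter_upwards [eventually_ge_atTop n] with k hk
      rw [div_le_iff₀ hpos] at hn
      have hk' : (n : ℝ) ≤ k := by exact_mod_cast hk
      have : η x - (1 / ((k : ℝ) + 1))⁻¹ * u x ≤ 0 := by
        rw [one_div, inv_inv]; nlinarith
      simp only [φ, η₀, if_neg hx]
      exact (max_eq_right this).symm
  -- Adding $\frac\delta4$ times the kernel of $\eta$ makes the integrand nonnegative, so Fatou
  -- applies; the supersolution property bounds its integral by a constant times $\delta$.
  set T : ℕ → EuclideanSpace ℝ (Fin N) × EuclideanSpace ℝ (Fin N) → ℝ := fun n z =>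
    1 / ((n : ℝ) + 1) / 4 * gagliardoKernel s η η z - gagliardoKernel s u (φ n) z
  have hTi : ∀ n, Integrable (T n) (volume.prod volume) := fun n =>
    (hη.finite_seminorm.const_mul _).sub (hu.integrable_kernel (hφ n))
  have hT0 : ∀ n z, 0 ≤ T n z := fun n z => by
    simp only [T, gagliardoKernel]
    rw [← mul_div_assoc, ← sub_div]
    refine div_nonneg (sub_nonneg.2 ?_) (by positivity)
    rw [← sq]
    exact sub_mul_posPart_sub_le (by positivity) _ _ _ _
  have hTlim : ∀ z, Tendsto (fun n => T n z) atTop (𝓝 (-gagliardoKernel s u η₀ z)) := fun z => by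
    have h1 : Tendsto (fun n : ℕ => 1 / ((n : ℝ) + 1) / 4 * gagliardoKernel s η η z) atTop
        (𝓝 (0 / 4 * gagliardoKernel s η η z)) :=
      (tendsto_one_div_add_atTop_nhds_zero_nat.div_const 4).mul_const _
    have h2 : Tendsto (fun n => gagliardoKernel s u (φ n) z) atTop (𝓝 (gagliardoKernel s u η₀ z)) :=
      (((hφlim z.1).sub (hφlim z.2)).const_mul _).div_const _
    have h3 := h1.sub h2
    rw [zero_div, zero_mul, zero_sub] at h3
    exact h3
  have hTint : ∀ n : ℕ, ∫ z, T n z ∂(volume.prod volume) ≤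
      1 / ((n : ℝ) + 1) * (2 / fracConst N s * (innerX s η η + M * ∫ x, η x * η x) / 4) := fun n => by
    set δ : ℝ := 1 / ((n : ℝ) + 1)
    have hδ : 0 < δ := by positivity
    have h1 : ∫ x, u x * φ n x ≤ δ / 4 * ∫ x, η x * η x := by
      rw [← integral_const_mul]
      refine integral_mono (hu.integrable_mul (hφ n)) ((hη.integrable_mul hη).const_mul _)
        fun x => ?_
      -- Taking the second pair of values to be $0$ turns the same inequality into a bound for the
      -- zero-order term.
      have := sub_mul_posPart_sub_le hδ (η x) 0 (u x) 0
      simp only [mul_zero, sub_zero, max_self, sq] at this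
      exact this
    have h2 := hsup _ (hφ n) fun x => le_max_right _ _
    have h3 : -innerX s u (φ n) ≤ M * (δ / 4 * ∫ x, η x * η x) := by
      have := mul_le_mul_of_nonneg_left h1 hM
      linarith
    simp only [T]
    rw [integral_sub (hη.finite_seminorm.const_mul _) (hu.integrable_kernel (hφ n)),
      integral_const_mul]
    have h4 : ∀ f g : EuclideanSpace ℝ (Fin N) → ℝ,
        ∫ z, gagliardoKernel s f g z ∂(volume.prod volume) = 2 / fracConst N s * innerX s f g :=
      fun f g => by rw [innerX]; field_simp
    rw [h4, h4]
    have h5 : 0 < 2 / fracConst N s := by positivity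
    have h6 := mul_le_mul_of_nonneg_left h3 h5.le
    linarith
  have hlim0 : ∀ B : ℝ, 0 < B → ∀ᶠ n in atTop, ∫ z, T n z ∂(volume.prod volume) ≤ B := by
    intro B hB
    have h1 := (tendsto_one_div_add_atTop_nhds_zero_nat (𝕜 := ℝ)).mul_const
      (2 / fracConst N s * (innerX s η η + M * ∫ x, η x * η x) / 4)
    rw [zero_mul] at h1
    filter_upwards [h1.eventually_lt_const hB] with n hn
    exact (hTint n).trans hn.le
  have hFatou := fun B hB => integral_le_of_tendsto_of_eventually_le hTi hT0
    (.of_forall hTlim) (hlim0 B hB)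
  have hu_mul : ∀ x, u x * η₀ x = 0 := fun x => by
    by_cases hx : u x = 0 <;> simp [η₀, hx]
  have hη₀0 : ∀ x, 0 ≤ η₀ x := fun x => by
    by_cases hx : u x = 0 <;> simp [η₀, hx, hη0 x]
  -- Since $u\eta_0=0$, only the cross terms remain, and they are nonnegative. The limiting integral
  -- is at most $0$, so they vanish for almost every pair.
  have hnum : ∀ z : EuclideanSpace ℝ (Fin N) × EuclideanSpace ℝ (Fin N),
      -((u z.1 - u z.2) * (η₀ z.1 - η₀ z.2)) = u z.1 * η₀ z.2 + u z.2 * η₀ z.1 := fun z => by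
    linear_combination -hu_mul z.1 - hu_mul z.2
  have hK0 : ∀ z, 0 ≤ -gagliardoKernel s u η₀ z := fun z =>
    ge_of_tendsto' (hTlim z) fun n => hT0 n z
  have hle : ∫ z, -gagliardoKernel s u η₀ z ∂(volume.prod volume) ≤ 0 :=
    le_of_forall_gt_imp_ge_of_dense fun B hB => (hFatou B hB).2
  have hae := (integral_eq_zero_iff_of_nonneg hK0 (hFatou 1 one_pos).1).1
    (le_antisymm hle (integral_nonneg hK0))
  have hae2 : ∀ᵐ z ∂((volume : Measure (EuclideanSpace ℝ (Fin N))).prod volume),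
      u z.2 * η₀ z.1 = 0 := by
    filter_upwards [hae] with z hz
    by_cases hzz : z.1 = z.2
    · rw [hzz]; exact hu_mul _
    · have hd : 0 < ‖z.1 - z.2‖ ^ ((N : ℝ) + 2 * s) :=
        Real.rpow_pos_of_pos (norm_pos_iff.2 (sub_ne_zero.2 hzz)) _
      simp only [gagliardoKernel, Pi.zero_apply] at hz
      rw [← neg_div, hnum, div_eq_zero_iff, or_iff_left hd.ne'] at hz
      linarith [mul_nonneg (hu0 z.1) (hη₀0 z.2), mul_nonneg (hu0 z.2) (hη₀0 z.1)]
  -- At almost every $x\in\Omega$, $u(x)=0$ would give $\eta_0(x)>0$ and hence $u=0$ almost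
  -- everywhere. Nonlocality makes connectedness of $\Omega$ unnecessary.
  filter_upwards [Measure.ae_ae_of_ae_prod hae2] with x hx hxΩ
  refine (hu0 x).lt_of_ne fun h0 => hne ?_
  have hηx : η₀ x ≠ 0 := by
    simp only [η₀, ← h0, if_true]
    exact (distCompl_pos hN hΩ_open hΩ_bdd hxΩ).ne'
  filter_upwards [hx] with y hy
  exact (mul_eq_zero.1 hy).resolve_right hηx

lemma innerX_zero_right (s : ℝ) (u : EuclideanSpace ℝ (Fin N) → ℝ) : innerX s u 0 = 0 := by
  simp [innerX, gagliardoKernel]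

end FracSystem

end

/-! ### Assembly of the existence theorem -/

theorem theorem1 (N : ℕ) (s : ℝ) (hs0 : 0 < s) (hs1 : s < 1) (hN : 2 * s < (N : ℝ))
    (Ω : Set (EuclideanSpace ℝ (Fin N))) (hΩ_open : IsOpen Ω) (hΩ_nonempty : Ω.Nonempty)
    (hΩ_bdd : Bornology.IsBounded Ω)
    (p q : ℝ) (hp : 1 < p) (hq : 1 < q) (a b c μ₁ μ₂ : ℝ)
    (hμ : (!![a, b; b, c] : Matrix (Fin 2) (Fin 2) ℝ).charpoly.roots = {μ₁, μ₂})
    (hμ_le : μ₁ ≤ μ₂) (hb : 0 ≤ b) (hμ₂ : μ₂ < FracSystem.firstEigenvalue s Ω)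
    (hpq : p + q < FracSystem.critExp N s) :
    ∃ u v : EuclideanSpace ℝ (Fin N) → ℝ,
      FracSystem.IsPositiveSolution s Ω a b c p q u v := by
  have hN0 : 0 < N := by
    have : (0 : ℝ) < N := by linarith
    exact_mod_cast this
  obtain ⟨ε, hε, hcoer⟩ := FracSystem.exists_coercive hs0 hs1 hN hΩ_open hΩ_nonempty hΩ_bdd
    (FracSystem.quadratic_le_of_charpoly_roots hμ hμ_le) hμ₂
  obtain ⟨u, v, hu, hv, hu0, hv0, hune, hvne, hsol⟩ := FracSystem.exists_nonneg_solution hs0 hs1 hN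
    hΩ_open hΩ_nonempty hΩ_bdd hp hq hpq hb hε hcoer
  have hz := FracSystem.MemX.zero s Ω
  have hp' : 0 < p := by linarith
  have hq' : 0 < q := by linarith
  have hf : ∀ φ, FracSystem.MemX s Ω φ →
      Integrable (fun x => (a * u x + b * v x + 2 * p / (p + q) * (u x ^ (p - 1) * v x ^ q)) * φ x) ∧
      ∫ x, (a * u x + b * v x + 2 * p / (p + q) * (u x ^ (p - 1) * v x ^ q)) * φ x =
        a * (∫ x, u x * φ x) + b * (∫ x, v x * φ x) +
          2 * p / (p + q) * ∫ x, u x ^ (p - 1) * v x ^ q * φ x := by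
    intro φ hφ
    have i1 := (hu.integrable_mul hφ).const_mul a
    have i2 := (hv.integrable_mul hφ).const_mul b
    have i3 := (hsol φ 0 hφ hz).1.const_mul (2 * p / (p + q))
    have i12 : Integrable fun x => a * (u x * φ x) + b * (v x * φ x) := i1.add i2
    have he : (fun x => (a * u x + b * v x + 2 * p / (p + q) * (u x ^ (p - 1) * v x ^ q)) * φ x) =
        fun x => a * (u x * φ x) + b * (v x * φ x) +
          2 * p / (p + q) * (u x ^ (p - 1) * v x ^ q * φ x) := by funext x; ring
    rw [he]
    exact ⟨i12.add i3, by rw [integral_add i12 i3, integral_add i1 i2]; simp only [integral_const_mul]⟩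
  have hg : ∀ ψ, FracSystem.MemX s Ω ψ →
      Integrable (fun x => (b * u x + c * v x + 2 * q / (p + q) * (u x ^ p * v x ^ (q - 1))) * ψ x) ∧
      ∫ x, (b * u x + c * v x + 2 * q / (p + q) * (u x ^ p * v x ^ (q - 1))) * ψ x =
        b * (∫ x, u x * ψ x) + c * (∫ x, v x * ψ x) +
          2 * q / (p + q) * ∫ x, u x ^ p * v x ^ (q - 1) * ψ x := by
    intro ψ hψ
    have i1 := (hu.integrable_mul hψ).const_mul b
    have i2 := (hv.integrable_mul hψ).const_mul c
    have i3 := (hsol 0 ψ hz hψ).2.1.const_mul (2 * q / (p + q))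
    have i12 : Integrable fun x => b * (u x * ψ x) + c * (v x * ψ x) := i1.add i2
    have he : (fun x => (b * u x + c * v x + 2 * q / (p + q) * (u x ^ p * v x ^ (q - 1))) * ψ x) =
        fun x => b * (u x * ψ x) + c * (v x * ψ x) +
          2 * q / (p + q) * (u x ^ p * v x ^ (q - 1) * ψ x) := by funext x; ring
    rw [he]
    exact ⟨i12.add i3, by rw [integral_add i12 i3, integral_add i1 i2]; simp only [integral_const_mul]⟩
  have hweak : ∀ φ ψ, FracSystem.MemX s Ω φ → FracSystem.MemX s Ω ψ →
      FracSystem.innerX s u φ + FracSystem.innerX s v ψ =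
      (∫ x, (a * u x + b * v x + 2 * p / (p + q) * (u x ^ (p - 1) * v x ^ q)) * φ x) +
      ∫ x, (b * u x + c * v x + 2 * q / (p + q) * (u x ^ p * v x ^ (q - 1))) * ψ x := by
    intro φ ψ hφ hψ
    have h := (hsol φ ψ hφ hψ).2.2
    rw [FracSystem.pairForm] at h
    rw [(hf φ hφ).2, (hg ψ hψ).2]
    linarith
  -- For $\varphi\ge0$, the terms with $bv$ and with the nonlinearity are nonnegative, leaving
  -- $\langle u,\varphi\rangle_X\ge a\int u\varphi\ge-|a|\int u\varphi$.
  have hposu := FracSystem.ae_pos_of_supersolution hN0 hs0 hs1 hΩ_open hΩ_bdd hu hu0 hune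
    (abs_nonneg a) fun φ hφ hφ0 => by
      have h := hweak φ 0 hφ hz
      rw [(hf φ hφ).2, FracSystem.innerX_zero_right] at h
      simp only [Pi.zero_apply, mul_zero, integral_zero, add_zero] at h
      have h1 : 0 ≤ ∫ x, u x * φ x := integral_nonneg fun x => mul_nonneg (hu0 x) (hφ0 x)
      have h2 : 0 ≤ ∫ x, v x * φ x := integral_nonneg fun x => mul_nonneg (hv0 x) (hφ0 x)
      have h3 : 0 ≤ ∫ x, u x ^ (p - 1) * v x ^ q * φ x := integral_nonneg fun x => mul_nonneg
        (mul_nonneg (Real.rpow_nonneg (hu0 x) _) (Real.rpow_nonneg (hv0 x) _)) (hφ0 x)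
      have h4 : 0 ≤ 2 * p / (p + q) * ∫ x, u x ^ (p - 1) * v x ^ q * φ x := by positivity
      have h5 := mul_le_mul_of_nonneg_right (neg_abs_le a) h1
      rw [h]
      linarith [mul_nonneg hb h2]
  have hposv := FracSystem.ae_pos_of_supersolution hN0 hs0 hs1 hΩ_open hΩ_bdd hv hv0 hvne
    (abs_nonneg c) fun ψ hψ hψ0 => by
      have h := hweak 0 ψ hz hψ
      rw [(hg ψ hψ).2, FracSystem.innerX_zero_right] at h
      simp only [Pi.zero_apply, mul_zero, integral_zero, zero_add] at h
      have h1 : 0 ≤ ∫ x, v x * ψ x := integral_nonneg fun x => mul_nonneg (hv0 x) (hψ0 x)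
      have h2 : 0 ≤ ∫ x, u x * ψ x := integral_nonneg fun x => mul_nonneg (hu0 x) (hψ0 x)
      have h3 : 0 ≤ ∫ x, u x ^ p * v x ^ (q - 1) * ψ x := integral_nonneg fun x => mul_nonneg
        (mul_nonneg (Real.rpow_nonneg (hu0 x) _) (Real.rpow_nonneg (hv0 x) _)) (hψ0 x)
      have h4 : 0 ≤ 2 * q / (p + q) * ∫ x, u x ^ p * v x ^ (q - 1) * ψ x := by positivity
      have h5 := mul_le_mul_of_nonneg_right (neg_abs_le c) h1
      rw [h]
      linarith [mul_nonneg hb h2]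
  refine ⟨u, v, ⟨hu, hv, fun φ hφ => (hf φ hφ).1.integrableOn,
    fun ψ hψ => (hg ψ hψ).1.integrableOn, fun φ ψ hφ hψ => ?_⟩, hposu, hposv⟩
  rw [hφ.setIntegral_eq, hψ.setIntegral_eq]
  exact hweak φ ψ hφ hψ
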